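/- **Setting.** For $X\in\mathbb R^{n\times p}$ and $1\le k\le p$ let $\gamma_k(X)$ be the largest $\gamma$ such that $\frac1n\|X\beta\|_2^2\ge\gamma\|\beta\|_2^2$ for all $\beta$ with $\|\beta_{S^c}\|_1\le 3\|\beta_S\|_1$ for some $S\subseteq[p]$, $|S|=k$ (the restricted eigenvalue). A *black box* is a (measurable) map $(y,X,k)\mapsto \mathsf{SLR}(y,X,k)\in\mathbb R^p$, for $y\in\mathbb R^n$, $X\in\mathbb R^{n\times p}$ and all $n,p,k$, whose output is always $k$-sparse. Fix constants $K>2$ and $c,c',c''>0$. We say that $\mathsf{SLR}$ satisfies the *black-box condition* if for all $n$, $k$ and $p\ge2$, every fixed design $X\in\mathbb R^{n\times p}$ with $\gamma_k(X)>0$ and $\frac1n\|X\beta\|_2^2\le K\|\beta\|_2^2$ for all $2k$-sparse $\beta$, every $\sigma>0$ and every $k$-sparse $\beta^*$, with $w\sim N(0,\sigma^2 I_n)$ and $\widehat\beta=\mathsf{SLR}(X\beta^*+w,X,k)$, $$\frac1n\|X\widehat\beta-X\beta^*\|_2^2\le\frac{c}{\gamma_k(X)^2}\,\frac{\sigma^2k\log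 p}{n}\quad\text{with probability at least }1-c'\exp(-c''k\log p).$$ **Test.** Given a data matrix $\mathbf X\in\mathbb R^{n\times d}$ with columns $\mathbf X_i$, let $\mathbf X_{-i}$ be $\mathbf X$ without its $i$-th column, $\widehat\beta_i=\mathsf{SLR}(\mathbf X_i,\mathbf X_{-i},k)$ and $Q_i=\frac1n\|\mathbf X_i\|_2^2-\frac1n\|\mathbf X_i-\mathbf X_{-i}\widehat\beta_i\|_2^2$. The algorithm returns $\psi(\mathbf X)=1$ if $Q_i>\frac{13k\log(d/k)}{n}$ for some $i\in[d]$, and $\psi(\mathbf X)=0$ otherwise. **Theorem.** (a) For all $K>2$ and $c,c',c''>0$ there are constants $c_1,c_2,c_3,c_4>0$, depending only on $K,c,c',c''$, such that the following holds for every $\mathsf{SLR}$ satisfying the black-box condition. Let $k\ge1$, $d\ge ek$, $0<\theta\le1$, $c_{\min}>0$, and let $u\in\mathbb R^d$ be a $k$-sparse unit vector with $c_{\min}^2/k\le u_i^2\le1-c_{\min}^2/k$ for at least one $i\in[d]$. Suppose that $$\theta^2>\frac{c_1}{c_{\min}^2}\,\frac{k^2\log d}{n}\qquad\text{and}\qquad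 n>c_2k\log d .$$ Let the rows of $\mathbf X$ be $n$ i.i.d. samples from $N(0,I_d)$ under $H_0$ and from $N(0,I_d+\theta uu^\top)$ under $H_1$. Then $$\mathbf P_{H_0}(\psi(\mathbf X)=1)\le c_3\exp\bigl(-c_4k\log(d/k)\bigr),\qquad \mathbf P_{H_1}(\psi(\mathbf X)=0)\le c_3\exp(-c_4k\log d).$$ In particular, for every $\varepsilon\in(0,1]$ with $k\le d^{1-\varepsilon}$, $$\mathbf P_{H_0}(\psi(\mathbf X)=1)\vee\mathbf P_{H_1}(\psi(\mathbf X)=0)\le c_3\exp(-c_4\,\varepsilon\,k\log d).$$ (b) On a random access machine with unit-cost operations on natural numbers (addition and truncated subtraction), real numbers (arithmetic, logarithm and comparison) and entries of real matrices, where a call of $\mathsf{SLR}$ with $n$ samples, $p$ variables and sparsity $k$ costs $T(p,n,k)$, a direct implementation of the algorithm computes $\psi(\mathbf X)$ in time $O\bigl(d\,T(d-1,n,k)+d^2n\bigr)$, with an absolute implied constant, for all $d,n\ge1$, all $k$ and all $\mathbf X$. -/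

import Mathlib

open MeasureTheory ProbabilityTheory
open scoped NNReal

/-! ### Sparse linear regression -/

/-- A data or design matrix with `n` rows (samples) and `p` columns (variables). -/
abbrev Design (n p : ℕ) : Type := Fin n → Fin p → ℝ

/-- Squared Euclidean norm. -/
def sqNorm {m : ℕ} (v : Fin m → ℝ) : ℝ := ∑ a, v a ^ 2

/-- The matrix-vector product `X β`. -/
def applyDesign {n p : ℕ} (X : Design n p) (β : Fin p → ℝ) : Fin n → ℝ :=
  fun a => ∑ j, X a j * β j

/-- The cone `{β : ‖β_{Sᶜ}‖₁ ≤ 3 ‖β_S‖₁}`. -/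
def reCone {p : ℕ} (S : Finset (Fin p)) : Set (Fin p → ℝ) :=
  {β | ∑ j ∈ Sᶜ, |β j| ≤ 3 * ∑ j ∈ S, |β j|}

/-- The restricted eigenvalue of `X` at sparsity `k`: the largest `γ` such that
`‖X β‖² / n ≥ γ ‖β‖²` for all `β` in the union of the cones over supports of size `k`.
(For `1 ≤ k ≤ p` the supremum is a maximum and is nonnegative.) -/
noncomputable def restrictedEigenvalue {n p : ℕ} (X : Design n p) (k : ℕ) : ℝ :=
  sSup {γ : ℝ | ∀ S : Finset (Fin p), S.card = k → ∀ β ∈ reCone S,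
    γ * sqNorm β ≤ sqNorm (applyDesign X β) / n}

/-- Normalization of the design on sparse directions, with constant `K`:
`‖X β‖² / n ≤ K ‖β‖²` for all `2k`-sparse `β`. -/
def IsNormalized {n p : ℕ} (K : ℝ) (X : Design n p) (k : ℕ) : Prop :=
  ∀ β : Fin p → ℝ, hammingNorm β ≤ 2 * k → sqNorm (applyDesign X β) / n ≤ K * sqNorm β

/-- An SLR black box: `SLR n p y X k` is the estimated regression vector for the response `y`,
the design `X` (`n` samples, `p` variables) and the sparsity `k`. -/
abbrev Solver : Type :=
  ∀ n p : ℕ, (Fin n → ℝ) → Design n p → ℕ → (Fin p → ℝ)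

/-- The law of a noise vector with `n` i.i.d. `N(0, σ²)` entries. -/
noncomputable def noiseLaw (n : ℕ) (σ : ℝ≥0) : Measure (Fin n → ℝ) :=
  Measure.pi fun _ => gaussianReal 0 (σ ^ 2)

/-- The black-box condition: the output is always `k`-sparse and, for every fixed (normalized)
design with at least two variables and positive restricted eigenvalue and every `k`-sparse `β*`, the prediction error from
`y = X β* + w` is at most `(c / γ(X)²) σ² k log p / n` with probability at least
`1 - c' exp(-c'' k log p)` over the noise `w`. -/
structure BlackBoxCondition (SLR : Solver) (K c c' c'' : ℝ) : Prop where
  measurable : ∀ n p k : ℕ,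
    Measurable fun q : (Fin n → ℝ) × Design n p => SLR n p q.1 q.2 k
  sparse : ∀ (n p k : ℕ) (y : Fin n → ℝ) (X : Design n p), hammingNorm (SLR n p y X k) ≤ k
  prediction_error : ∀ (n p k : ℕ) (X : Design n p), 2 ≤ p → IsNormalized K X k →
    0 < restrictedEigenvalue X k →
    ∀ σ : ℝ≥0, 0 < σ → ∀ βstar : Fin p → ℝ, hammingNorm βstar ≤ k →
      1 - c' * Real.exp (-(c'' * k * Real.log p)) ≤
        (noiseLaw n σ).real
          {w | sqNorm (applyDesign X (SLR n p (applyDesign X βstar + w) X k)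
                  - applyDesign X βstar) / n
                ≤ c / restrictedEigenvalue X k ^ 2 * ((σ : ℝ) ^ 2 * k * Real.log p / n)}

/-! ### The spiked covariance model -/

/-- The law of `n` i.i.d. samples from `N(0, Γ)` in `ℝ^d`. -/
noncomputable def sampleLaw (n d : ℕ) (Γ : Matrix (Fin d) (Fin d) ℝ) :
    Measure (Fin n → EuclideanSpace ℝ (Fin d)) :=
  Measure.pi fun _ => multivariateGaussian 0 Γ

/-- The data matrix whose rows are the samples. -/
def dataMatrix {n d : ℕ} (x : Fin n → EuclideanSpace ℝ (Fin d)) : Design n d :=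
  fun a i => x a i

/-- The spiked covariance matrix `I + θ u uᵀ`. -/
def spikedCov {d : ℕ} (θ : ℝ) (u : Fin d → ℝ) : Matrix (Fin d) (Fin d) ℝ :=
  1 + θ • Matrix.vecMulVec u u

/-! ### The test -/

/-- The `j`-th index of `{0, …, d-1}` with `i` left out, in increasing order. -/
def skipIndex {d : ℕ} (i : Fin d) (j : Fin (d - 1)) : Fin d :=
  ⟨if (j : ℕ) < i then j else j + 1, by split <;> omega⟩

/-- The `i`-th column `X_i`. -/
def column {n d : ℕ} (X : Design n d) (i : Fin d) : Fin n → ℝ := fun a => X a i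

/-- The matrix `X_{-i}`: the `i`-th column removed. -/
def dropColumn {n d : ℕ} (X : Design n d) (i : Fin d) : Design n (d - 1) :=
  fun a j => X a (skipIndex i j)

/-- `Q_i = ‖X_i‖²/n - ‖X_i - X_{-i} β̂_i‖²/n` with `β̂_i = SLR(X_i, X_{-i}, k)`. -/
noncomputable def qStat (SLR : Solver) {n d : ℕ} (X : Design n d) (k : ℕ) (i : Fin d) : ℝ :=
  sqNorm (column X i) / n -
    sqNorm (column X i -
      applyDesign (dropColumn X i) (SLR n (d - 1) (column X i) (dropColumn X i) k)) / n

/-- The threshold `13 k log(d/k) / n`. -/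
noncomputable def qThreshold (n d k : ℕ) : ℝ := 13 * k * Real.log (d / k) / n

open Classical in
/-- The output of the test: `1` if some `Q_i` exceeds the threshold, and `0` otherwise. -/
noncomputable def qTest (SLR : Solver) {n d : ℕ} (X : Design n d) (k : ℕ) : ℕ :=
  if ∃ i : Fin d, qThreshold n d k < qStat SLR X k i then 1 else 0

/-- Type I error of the test: the probability of the output `1` under `N(0, I)`. -/
noncomputable def typeIError (SLR : Solver) (n d k : ℕ) : ℝ :=
  (sampleLaw n d 1).real {x | qTest SLR (dataMatrix x) k = 1}

/-- Type II error of the test: the probability of the output `0` under `N(0, I + θ u uᵀ)`. -/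
noncomputable def typeIIError (SLR : Solver) (n d k : ℕ) (θ : ℝ) (u : Fin d → ℝ) : ℝ :=
  (sampleLaw n d (spikedCov θ u)).real {x | qTest SLR (dataMatrix x) k = 0}

/-! ### A real random access machine with a regression oracle

Programs act on registers holding natural numbers (indices and sizes), registers holding reals,
and two-dimensional arrays of reals.  Every elementary instruction takes one step; a call of the
black box on an instance with `n` samples, `p` variables and sparsity `k` takes `T p n k` steps
(in addition to one step for the call, and to the steps that write the instance into memory). -/

/-- Programs. Registers and arrays are named by natural numbers. -/
inductive Prog : Type
  /-- `x := c` -/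
  | natConst (x c : ℕ)
  /-- `x := y + z` -/
  | natAdd (x y z : ℕ)
  /-- `x := y - z`, truncated at zero -/
  | natSub (x y z : ℕ)
  /-- `r := c` -/
  | realConst (r c : ℕ)
  /-- `r := x`, for a natural number register `x` -/
  | realOfNat (r x : ℕ)
  /-- `r := a + b` -/
  | realAdd (r a b : ℕ)
  /-- `r := a - b` -/
  | realSub (r a b : ℕ)
  /-- `r := a * b` -/
  | realMul (r a b : ℕ)
  /-- `r := a / b` -/
  | realDiv (r a b : ℕ)
  /-- `r := log a` -/
  | realLog (r a : ℕ)
  /-- `r := A[x][y]` -/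
  | load (r A x y : ℕ)
  /-- `A[x][y] := r` -/
  | store (A x y r : ℕ)
  /-- do nothing -/
  | skip
  /-- sequential composition -/
  | seq (P Q : Prog)
  /-- `if x < y then P else Q`, for natural number registers -/
  | natIfLt (x y : ℕ) (P Q : Prog)
  /-- `if a < b then P else Q`, for real registers -/
  | realIfLt (a b : ℕ) (P Q : Prog)
  /-- `for x = 0, …, N - 1 do P`, where `N` is the content of register `m` at the start -/
  | loop (x m : ℕ) (P : Prog)
  /-- `B := SLR(A, D, k)`: the response is column `0` of array `A` (`n` entries), the design is the
  upper left `n × p` block of array `D`, and the result is written to column `0` of array `B`;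
  the sizes `n`, `p`, `k` are read from registers `xn`, `xp`, `xk`. -/
  | call (A D B xn xp xk : ℕ)

/-- Memory contents. -/
structure MachineState where
  /-- natural number registers -/
  nat : ℕ → ℕ
  /-- real registers -/
  real : ℕ → ℝ
  /-- arrays: `mem A x y` is the entry in row `x` and column `y` of array `A` -/
  mem : ℕ → ℕ → ℕ → ℝ

namespace MachineState

/-- Write a natural number register. -/
def setNat (s : MachineState) (x v : ℕ) : MachineState :=
  { s with nat := fun y => if y = x then v else s.nat y }

/-- Write a real register. -/
def setReal (s : MachineState) (r : ℕ) (v : ℝ) : MachineState :=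
  { s with real := fun q => if q = r then v else s.real q }

/-- Write an array entry. -/
def setMem (s : MachineState) (A x y : ℕ) (v : ℝ) : MachineState :=
  { s with mem := fun A' x' y' => if A' = A ∧ x' = x ∧ y' = y then v else s.mem A' x' y' }

/-- Write a vector of length `p` to column `0` of an array. -/
def setVec (s : MachineState) (A : ℕ) {p : ℕ} (v : Fin p → ℝ) : MachineState :=
  { s with mem := fun A' x' y' =>
      if h : A' = A ∧ x' < p ∧ y' = 0 then v ⟨x', h.2.1⟩ else s.mem A' x' y' }

end MachineState

/-- Iterate a timed state transformer over `0, …, N - 1` with loop register `x`; each round costs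
one step more than the body. -/
def runLoop (f : MachineState → MachineState × ℕ) (x : ℕ) (s : MachineState) :
    ℕ → MachineState × ℕ
  | 0 => (s, 1)
  | i + 1 =>
    let before := runLoop f x s i
    let after := f (before.1.setNat x i)
    (after.1, before.2 + after.2 + 1)

open Classical in
/-- The final state and the number of steps of a program. -/
noncomputable def Prog.exec (SLR : Solver) (T : ℕ → ℕ → ℕ → ℕ) :
    Prog → MachineState → MachineState × ℕ
  | natConst x c, s => (s.setNat x c, 1)
  | natAdd x y z, s => (s.setNat x (s.nat y + s.nat z), 1)
  | natSub x y z, s => (s.setNat x (s.nat y - s.nat z), 1)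
  | realConst r c, s => (s.setReal r c, 1)
  | realOfNat r x, s => (s.setReal r (s.nat x), 1)
  | realAdd r a b, s => (s.setReal r (s.real a + s.real b), 1)
  | realSub r a b, s => (s.setReal r (s.real a - s.real b), 1)
  | realMul r a b, s => (s.setReal r (s.real a * s.real b), 1)
  | realDiv r a b, s => (s.setReal r (s.real a / s.real b), 1)
  | realLog r a, s => (s.setReal r (Real.log (s.real a)), 1)
  | load r A x y, s => (s.setReal r (s.mem A (s.nat x) (s.nat y)), 1)
  | store A x y r, s => (s.setMem A (s.nat x) (s.nat y) (s.real r), 1)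
  | skip, s => (s, 1)
  | seq P Q, s =>
    let first := P.exec SLR T s
    let second := Q.exec SLR T first.1
    (second.1, first.2 + second.2)
  | natIfLt x y P Q, s =>
    let branch := if s.nat x < s.nat y then P.exec SLR T s else Q.exec SLR T s
    (branch.1, branch.2 + 1)
  | realIfLt a b P Q, s =>
    let branch := if s.real a < s.real b then P.exec SLR T s else Q.exec SLR T s
    (branch.1, branch.2 + 1)
  | loop x m P, s => runLoop (P.exec SLR T) x s (s.nat m)
  | call A D B xn xp xk, s =>
    (s.setVec B (SLR (s.nat xn) (s.nat xp) (fun a => s.mem A a 0) (fun a j => s.mem D a j)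
        (s.nat xk)),
      T (s.nat xp) (s.nat xn) (s.nat xk) + 1)

/-- Sequential composition of a list of programs. -/
def Prog.block : List Prog → Prog
  | [] => Prog.skip
  | P :: Ps => Prog.seq P (Prog.block Ps)

/-- The initial state: the data matrix is in array `0`, and `n`, `d`, `k` are in the natural number
registers `0`, `1`, `2`; everything else is zero. -/
def inputState {n d : ℕ} (X : Design n d) (k : ℕ) : MachineState where
  nat := fun x => if x = 0 then n else if x = 1 then d else if x = 2 then k else 0
  real := fun _ => 0
  mem := fun A a i =>
    if h : A = 0 ∧ a < n ∧ i < d then X ⟨a, h.2.1⟩ ⟨i, h.2.2⟩ else 0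

namespace QProgram

/-! Natural number registers: `0, 1, 2` hold `n, d, k`; `3` the output; `4` the constant `0`;
`5` the constant `1`; `6` the number `p = d - 1`; `7` the loop index `i`; `8` the row index `a`;
`9` the column index `j`; `10` the index of the `j`-th column other than `i`.
Arrays: `0` the data, `1` the response, `2` the design, `3` the estimate.
Real registers: `0` the threshold, `1` the number `n`, `2` the sum `‖X_i‖²`, `3` the residual sum
of squares, `4` a residual, `5` and `6` temporary, `7` and `8` the numbers `d` and `k`. -/

/-- Constants and the threshold `13 k log(d/k) / n`. -/
def setup : Prog := Prog.block [
  .natConst 3 0, .natConst 4 0, .natConst 5 1, .natSub 6 1 5,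
  .realOfNat 1 0, .realOfNat 7 1, .realOfNat 8 2,
  .realDiv 5 7 8, .realLog 5 5,
  .realConst 0 13, .realMul 0 0 8, .realMul 0 0 5, .realDiv 0 0 1]

/-- Write the instance `(X_i, X_{-i})` to the arrays `1` and `2`. -/
def writeInstance : Prog :=
  .loop 8 0 (Prog.block [
    .load 5 0 8 7, .store 1 8 4 5,
    .loop 9 6 (Prog.block [
      .natIfLt 9 7 (.natAdd 10 9 4) (.natAdd 10 9 5),
      .load 5 0 8 10, .store 2 8 9 5])])

/-- Compute `‖X_i‖²` and `‖X_i - X_{-i} β̂_i‖²`. -/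
def sums : Prog := Prog.block [
  .realConst 2 0, .realConst 3 0,
  .loop 8 0 (Prog.block [
    .load 4 1 8 4,
    .realMul 5 4 4, .realAdd 2 2 5,
    .loop 9 6 (Prog.block [
      .load 5 2 8 9, .load 6 3 9 4, .realMul 5 5 6, .realSub 4 4 5]),
    .realMul 5 4 4, .realAdd 3 3 5])]

/-- The test: for every `i` call the black box, compute `Q_i`, and set the output to `1` if it
exceeds the threshold. -/
def main : Prog := .seq setup (.loop 7 1 (Prog.block [
  writeInstance,
  .call 1 2 3 0 6 2,
  sums,
  .realDiv 2 2 1, .realDiv 3 3 1, .realSub 5 2 3,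
  .realIfLt 0 5 (.natConst 3 1) .skip]))

end QProgram

/-! Under `H₀` the response `X_i` is white noise independent of `X_{-i}`. For `k`-sparse `β` the
gain `‖y‖² - ‖y - Xβ‖²` is at most the squared norm of the projection of `y` to a span of `k`
columns, a chi-squared variable with at most `k` degrees of freedom, and a union bound over the
supports and over `i` gives the type I bound, whatever the black box does.

Under `H₁` choose `i` with `u_i²` bounded away from `0` and `1`. Then `X_i = X_{-i} β + w`, where
`β` is a multiple of `u_{-i}` and `w` is white noise independent of `X_{-i}`. The black-box
condition for `X_{-i}` bounds the prediction error, so the gain is at least half the signal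
`‖X_{-i} β‖²` up to terms of order `k log d`, whereas the signal is of order `n ‖β‖²`, hence at
least of order `n θ² c_min² / k`. That `X_{-i}` satisfies the hypotheses of the black-box condition
follows by Maurey's empirical method: a vector `x` with `‖x‖₁² = O(k ‖x‖₂²)` is the mean of a
random multiple of a signed basis vector, so the sums of `O(k)` independent copies, of which there
are only finitely many, control the quadratic form `‖Xx‖²` at `x`. -/

/-! ### Squared norms of Gaussian vectors -/

lemma gaussianPDFReal_mul_exp_mul_sq (t x : ℝ) :
    gaussianPDFReal 0 1 x * Real.exp (t * x ^ 2) =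
      (√(2 * Real.pi))⁻¹ * Real.exp (-(1 / 2 - t) * x ^ 2) := by
  simp only [gaussianPDFReal, NNReal.coe_one, mul_one, sub_zero]
  rw [mul_assoc, ← Real.exp_add]
  congr 2
  ring

lemma integrable_exp_mul_sq_gaussianReal {t : ℝ} (ht : t < 1 / 2) :
    Integrable (fun x ↦ Real.exp (t * x ^ 2)) (gaussianReal 0 1) := by
  rw [gaussianReal_of_var_ne_zero _ one_ne_zero, gaussianPDF_def,
    integrable_withDensity_iff_integrable_smul' (by fun_prop) (by simp)]
  simp_rw [ENNReal.toReal_ofReal (gaussianPDFReal_nonneg _ _ _), smul_eq_mul,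
    gaussianPDFReal_mul_exp_mul_sq]
  exact (integrable_exp_neg_mul_sq (by linarith)).const_mul _

lemma mgf_sq_gaussianReal {t : ℝ} (ht : t < 1 / 2) :
    mgf (fun x ↦ x ^ 2) (gaussianReal 0 1) t = (√(1 - 2 * t))⁻¹ := by
  simp_rw [mgf, integral_gaussianReal_eq_integral_smul one_ne_zero, smul_eq_mul,
    gaussianPDFReal_mul_exp_mul_sq]
  rw [integral_const_mul, integral_gaussian, ← Real.sqrt_inv, ← Real.sqrt_inv,
    ← Real.sqrt_mul (by positivity)]
  congr 1
  have h : 1 - 2 * t ≠ 0 := by linarith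
  field_simp

/-- The large-deviation rate of `‖w‖² / n` at `κ` for a standard Gaussian vector `w` in dimension
`n`: the probability of lying beyond `κ`, on the side away from the mean `1`, is at most
`exp(-chiRate κ * n)`. -/
noncomputable def chiRate (κ : ℝ) : ℝ := (κ - 1 - Real.log κ) / 2

lemma chiRate_pos {κ : ℝ} (h0 : 0 < κ) (h1 : κ ≠ 1) : 0 < chiRate κ := by
  have := Real.log_lt_sub_one_of_pos h0 h1
  unfold chiRate
  linarith

/-- The optimal exponent in the Chernoff bound for `‖w‖² / n` at `κ`. -/
noncomputable def chiExponent (κ : ℝ) : ℝ := (1 - κ⁻¹) / 2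

lemma chernoff_chiExponent {κ : ℝ} (h0 : 0 < κ) (n : ℕ) :
    Real.exp (-chiExponent κ * (κ * n)) * (√(1 - 2 * chiExponent κ))⁻¹ ^ n =
      Real.exp (-(chiRate κ * n)) := by
  have hsqrt : (√(1 - 2 * chiExponent κ))⁻¹ = Real.exp (Real.log κ / 2) := by
    rw [chiExponent, show 1 - 2 * ((1 - κ⁻¹) / 2) = κ⁻¹ by ring, Real.sqrt_inv, inv_inv,
      Real.exp_half, Real.exp_log h0]
  rw [hsqrt, ← Real.exp_nat_mul, ← Real.exp_add, chiRate, chiExponent]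
  congr 1
  field_simp
  ring

section StdGaussian

variable {E : Type*} [NormedAddCommGroup E] [InnerProductSpace ℝ E]

lemma norm_sq_sum_smul_orthonormalBasis {ι : Type*} [Fintype ι] (b : OrthonormalBasis ι ℝ E)
    (x : ι → ℝ) : ‖∑ i, x i • b i‖ ^ 2 = ∑ i, x i ^ 2 := by
  rw [← b.equiv_apply_euclideanSpace (WithLp.toLp 2 x), LinearIsometryEquiv.norm_map,
    EuclideanSpace.real_norm_sq_eq]

lemma exp_mul_norm_sq_sum_smul {ι : Type*} [Fintype ι] (b : OrthonormalBasis ι ℝ E) (t : ℝ)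
    (x : ι → ℝ) :
    Real.exp (t * ‖∑ i, x i • b i‖ ^ 2) = ∏ i, Real.exp (t * x i ^ 2) := by
  rw [norm_sq_sum_smul_orthonormalBasis, Finset.mul_sum, Real.exp_sum]

lemma two_mul_inner_sub_norm_sq_le {V : Submodule ℝ E} [V.HasOrthogonalProjection] {v : E}
    (hv : v ∈ V) (w : E) :
    2 * inner ℝ w v - ‖v‖ ^ 2 ≤ ‖V.orthogonalProjectionOnto w‖ ^ 2 := by
  have hinner : inner ℝ (V.orthogonalProjectionOnto w) ⟨v, hv⟩ = inner ℝ w v := by simp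
  have hsq := norm_sub_sq_real (V.orthogonalProjectionOnto w) ⟨v, hv⟩
  rw [hinner, Submodule.coe_norm ⟨v, hv⟩] at hsq
  nlinarith [sq_nonneg ‖V.orthogonalProjectionOnto w - ⟨v, hv⟩‖]

variable [FiniteDimensional ℝ E] [MeasurableSpace E] [BorelSpace E] {t : ℝ}

lemma integrable_exp_mul_norm_sq_stdGaussian (ht : t < 1 / 2) :
    Integrable (fun w ↦ Real.exp (t * ‖w‖ ^ 2)) (stdGaussian E) := by
  rw [stdGaussian, integrable_map_measure (by fun_prop) (Measurable.aemeasurable (by fun_prop))]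
  simp only [Function.comp_def, exp_mul_norm_sq_sum_smul]
  exact Integrable.fintype_prod fun _ ↦ integrable_exp_mul_sq_gaussianReal ht

lemma mgf_norm_sq_stdGaussian (ht : t < 1 / 2) :
    mgf (fun w ↦ ‖w‖ ^ 2) (stdGaussian E) t = (√(1 - 2 * t))⁻¹ ^ Module.finrank ℝ E := by
  rw [mgf, stdGaussian, integral_map (Measurable.aemeasurable (by fun_prop)) (by fun_prop)]
  simp only [exp_mul_norm_sq_sum_smul]
  rw [integral_fintype_prod_eq_prod fun _ x ↦ Real.exp (t * x ^ 2), Finset.prod_const,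
    Finset.card_fin, ← mgf_sq_gaussianReal ht, mgf]

lemma stdGaussian_real_le_norm_sq_le (h0 : 0 ≤ t) (ht : t < 1 / 2) (T : ℝ) :
    (stdGaussian E).real {w | T ≤ ‖w‖ ^ 2} ≤
      Real.exp (-t * T) * (√(1 - 2 * t))⁻¹ ^ Module.finrank ℝ E :=
  mgf_norm_sq_stdGaussian (E := E) ht ▸
    measure_ge_le_exp_mul_mgf T h0 (integrable_exp_mul_norm_sq_stdGaussian ht)

lemma stdGaussian_real_norm_sq_le_le (h0 : t ≤ 0) (T : ℝ) :
    (stdGaussian E).real {w | ‖w‖ ^ 2 ≤ T} ≤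
      Real.exp (-t * T) * (√(1 - 2 * t))⁻¹ ^ Module.finrank ℝ E := by
  have ht : t < 1 / 2 := by linarith
  exact mgf_norm_sq_stdGaussian (E := E) ht ▸
    measure_le_le_exp_mul_mgf T h0 (integrable_exp_mul_norm_sq_stdGaussian ht)

lemma stdGaussian_real_mul_finrank_le_norm_sq_le {κ : ℝ} (h1 : 1 < κ) :
    (stdGaussian E).real {w | κ * Module.finrank ℝ E ≤ ‖w‖ ^ 2} ≤
      Real.exp (-(chiRate κ * Module.finrank ℝ E)) := by
  have h0 : 0 < κ := by linarith
  have hpos : 0 < κ⁻¹ := by positivity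
  have hlt : κ⁻¹ < 1 := inv_lt_one_of_one_lt₀ h1
  rw [← chernoff_chiExponent h0]
  exact stdGaussian_real_le_norm_sq_le (by unfold chiExponent; linarith)
    (by unfold chiExponent; linarith) _

lemma stdGaussian_real_norm_sq_le_mul_finrank_le {κ : ℝ} (h0 : 0 < κ) (h1 : κ < 1) :
    (stdGaussian E).real {w | ‖w‖ ^ 2 ≤ κ * Module.finrank ℝ E} ≤
      Real.exp (-(chiRate κ * Module.finrank ℝ E)) := by
  have hlt : 1 < κ⁻¹ := (one_lt_inv₀ h0).2 h1
  rw [← chernoff_chiExponent h0]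
  exact stdGaussian_real_norm_sq_le_le (by unfold chiExponent; linarith) _

lemma map_orthogonalProjectionOnto_stdGaussian (V : Submodule ℝ E) :
    (stdGaussian E).map V.orthogonalProjectionOnto = stdGaussian V := by
  refine Measure.ext_of_charFun (funext fun v ↦ ?_)
  have : ∀ w, inner ℝ (V.orthogonalProjectionOnto w) v = inner ℝ w (v : E) := fun w ↦ by simp
  rw [charFun_stdGaussian, charFun_apply, integral_map (by fun_prop) (by fun_prop)]
  simp_rw [this]
  rw [← charFun_apply, charFun_stdGaussian, Submodule.coe_norm]

lemma stdGaussian_real_le_norm_sq_orthogonalProjectionOnto_le (V : Submodule ℝ E) (T : ℝ) :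
    (stdGaussian E).real {w | T ≤ ‖V.orthogonalProjectionOnto w‖ ^ 2} ≤
      2 ^ Module.finrank ℝ V * Real.exp (-(3 / 8 * T)) := by
  have hsqrt : (√(1 - 2 * (3 / 8)))⁻¹ = (2 : ℝ) := by
    rw [show (1 - 2 * (3 / 8) : ℝ) = (1 / 2) ^ 2 by norm_num, Real.sqrt_sq (by norm_num)]
    norm_num
  calc (stdGaussian E).real {w | T ≤ ‖V.orthogonalProjectionOnto w‖ ^ 2}
      = (stdGaussian V).real {v | T ≤ ‖v‖ ^ 2} := by
        rw [← map_orthogonalProjectionOnto_stdGaussian, map_measureReal_apply (by fun_prop)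
          (measurableSet_le measurable_const (by fun_prop))]
        rfl
    _ ≤ Real.exp (-(3 / 8) * T) * (√(1 - 2 * (3 / 8)))⁻¹ ^ Module.finrank ℝ V :=
        stdGaussian_real_le_norm_sq_le (by norm_num) (by norm_num) T
    _ = 2 ^ Module.finrank ℝ V * Real.exp (-(3 / 8 * T)) := by rw [hsqrt, mul_comm, neg_mul]

end StdGaussian

/-! ### Designs and Gaussian noise -/

section Design

variable {n p : ℕ} (X : Design n p)

lemma applyDesign_smul (r : ℝ) (β : Fin p → ℝ) :
    applyDesign X (r • β) = r • applyDesign X β := by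
  ext a
  simp [applyDesign, Finset.mul_sum, mul_left_comm]

lemma applyDesign_sub (β γ : Fin p → ℝ) :
    applyDesign X (β - γ) = applyDesign X β - applyDesign X γ := by
  ext a
  simp [applyDesign, mul_sub, Finset.sum_sub_distrib]

lemma sqNorm_smul {m : ℕ} (r : ℝ) (v : Fin m → ℝ) : sqNorm (r • v) = r ^ 2 * sqNorm v := by
  simp [sqNorm, mul_pow, Finset.mul_sum]

lemma sqNorm_nonneg {m : ℕ} (v : Fin m → ℝ) : 0 ≤ sqNorm v :=
  Finset.sum_nonneg fun _ _ ↦ sq_nonneg _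

lemma sqNorm_eq_norm_sq {m : ℕ} (v : Fin m → ℝ) : sqNorm v = ‖WithLp.toLp 2 v‖ ^ 2 :=
  (EuclideanSpace.real_norm_sq_eq _).symm

lemma sqNorm_smul_ofLp {m : ℕ} (r : ℝ) (w : EuclideanSpace ℝ (Fin m)) :
    sqNorm (r • w.ofLp) = r ^ 2 * ‖w‖ ^ 2 := by
  rw [sqNorm_smul, sqNorm_eq_norm_sq]

lemma measurable_sqNorm {m : ℕ} : Measurable (sqNorm : (Fin m → ℝ) → ℝ) := by
  unfold sqNorm
  fun_prop

/-- The span of the columns of the design with index in `S`. -/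
def columnSpan (S : Finset (Fin p)) : Submodule ℝ (EuclideanSpace ℝ (Fin n)) :=
  Submodule.span ℝ (Set.range fun j : S ↦ WithLp.toLp 2 (column X j))

lemma finrank_columnSpan_le (S : Finset (Fin p)) :
    Module.finrank ℝ (columnSpan X S) ≤ S.card :=
  (finrank_range_le_card _).trans_eq (Fintype.card_coe S)

lemma toLp_applyDesign_mem_columnSpan {β : Fin p → ℝ} {S : Finset (Fin p)}
    (hS : ∀ j, β j ≠ 0 → j ∈ S) : WithLp.toLp 2 (applyDesign X β) ∈ columnSpan X S := by
  have hsum : WithLp.toLp 2 (applyDesign X β) =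
      ∑ j, β j • (WithLp.toLp 2 (column X j) : EuclideanSpace ℝ (Fin n)) := by
    ext a
    simp [applyDesign, column, mul_comm]
  rw [hsum]
  refine Submodule.sum_mem _ fun j _ ↦ ?_
  by_cases hj : β j = 0
  · rw [hj, zero_smul]
    exact Submodule.zero_mem _
  · exact Submodule.smul_mem _ _ (Submodule.subset_span ⟨⟨j, hS j hj⟩, rfl⟩)

end Design

section NoiseLaw

variable {n : ℕ} {σ : ℝ≥0}

instance : IsProbabilityMeasure (noiseLaw n σ) := by
  unfold noiseLaw
  infer_instance

variable (n σ) in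
lemma map_smul_ofLp_stdGaussian :
    (stdGaussian (EuclideanSpace ℝ (Fin n))).map (fun w ↦ (σ : ℝ) • w.ofLp) = noiseLaw n σ := by
  have hmul : (gaussianReal 0 1).map (fun x ↦ (σ : ℝ) * x) = gaussianReal 0 (σ ^ 2) := by
    rw [gaussianReal_map_const_mul]
    congr 1
    · simp
    · ext
      simp
  rw [← map_pi_eq_stdGaussian, Measure.map_map (by fun_prop) (by fun_prop), noiseLaw, ← hmul,
    ← Measure.pi_map_pi fun _ ↦ by fun_prop]
  rfl

lemma noiseLaw_real_sqNorm_lt_le {κ : ℝ} (h0 : 0 < κ) (h1 : κ < 1) :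
    (noiseLaw n σ).real {w | sqNorm w < κ * n * σ ^ 2} ≤ Real.exp (-(chiRate κ * n)) := by
  rw [← map_smul_ofLp_stdGaussian, map_measureReal_apply (by fun_prop)
    (measurableSet_lt measurable_sqNorm measurable_const)]
  have hle := stdGaussian_real_norm_sq_le_mul_finrank_le (E := EuclideanSpace ℝ (Fin n)) h0 h1
  rw [finrank_euclideanSpace_fin] at hle
  refine (measureReal_mono fun w hw ↦ ?_).trans hle
  simp only [Set.mem_preimage, Set.mem_ofPred_eq, sqNorm_smul_ofLp] at hw ⊢
  exact (lt_of_mul_lt_mul_left (hw.trans_eq (mul_comm _ _)) (sq_nonneg (σ : ℝ))).le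

lemma noiseLaw_real_lt_sqNorm_le {κ : ℝ} (h1 : 1 < κ) :
    (noiseLaw n σ).real {w | κ * n * σ ^ 2 < sqNorm w} ≤ Real.exp (-(chiRate κ * n)) := by
  rw [← map_smul_ofLp_stdGaussian, map_measureReal_apply (by fun_prop)
    (measurableSet_lt measurable_const measurable_sqNorm)]
  have hle := stdGaussian_real_mul_finrank_le_norm_sq_le (E := EuclideanSpace ℝ (Fin n)) h1
  rw [finrank_euclideanSpace_fin] at hle
  refine (measureReal_mono fun w hw ↦ ?_).trans hle
  simp only [Set.mem_preimage, Set.mem_ofPred_eq, sqNorm_smul_ofLp] at hw ⊢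
  exact (lt_of_mul_lt_mul_left ((mul_comm _ _).trans_lt hw) (sq_nonneg (σ : ℝ))).le

lemma noiseLaw_real_lt_norm_sq_orthogonalProjectionOnto_le
    (V : Submodule ℝ (EuclideanSpace ℝ (Fin n))) (T : ℝ) :
    (noiseLaw n σ).real
        {w | (σ : ℝ) ^ 2 * T < ‖V.orthogonalProjectionOnto (WithLp.toLp 2 w)‖ ^ 2} ≤
      2 ^ Module.finrank ℝ V * Real.exp (-(3 / 8 * T)) := by
  rw [← map_smul_ofLp_stdGaussian, map_measureReal_apply (by fun_prop)
    (measurableSet_lt measurable_const (by fun_prop))]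
  refine (measureReal_mono fun w hw ↦ ?_).trans
    (stdGaussian_real_le_norm_sq_orthogonalProjectionOnto_le V T)
  simp only [Set.mem_preimage, Set.mem_ofPred_eq, WithLp.toLp_smul, WithLp.toLp_ofLp, map_smul,
    norm_smul, mul_pow, Real.norm_eq_abs, sq_abs] at hw ⊢
  exact (lt_of_mul_lt_mul_left hw (sq_nonneg (σ : ℝ))).le

lemma two_mul_sum_sub_sqNorm_le {p : ℕ} {X : Design n p} {β : Fin p → ℝ} {S : Finset (Fin p)}
    (hS : ∀ j, β j ≠ 0 → j ∈ S) (w : Fin n → ℝ) :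
    2 * ∑ a, w a * applyDesign X β a - sqNorm (applyDesign X β) ≤
      ‖(columnSpan X S).orthogonalProjectionOnto (WithLp.toLp 2 w)‖ ^ 2 := by
  have hinner : inner ℝ (WithLp.toLp 2 w) (WithLp.toLp 2 (applyDesign X β)) =
      ∑ a, w a * applyDesign X β a := by
    simp [PiLp.inner_apply, mul_comm]
  rw [← hinner, sqNorm_eq_norm_sq]
  exact two_mul_inner_sub_norm_sq_le (toLp_applyDesign_mem_columnSpan X hS) _

lemma noiseLaw_real_exists_sparse_lt_le {p s : ℕ} (X : Design n p) (hs : s ≤ p) (T : ℝ) :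
    (noiseLaw n σ).real {w | ∃ β : Fin p → ℝ, hammingNorm β ≤ s ∧
        (σ : ℝ) ^ 2 * T < 2 * ∑ a, w a * applyDesign X β a - sqNorm (applyDesign X β)} ≤
      p.choose s * (2 ^ s * Real.exp (-(3 / 8 * T))) := by
  let tail (S : Finset (Fin p)) : Set (Fin n → ℝ) :=
    {w | (σ : ℝ) ^ 2 * T < ‖(columnSpan X S).orthogonalProjectionOnto (WithLp.toLp 2 w)‖ ^ 2}
  calc _ ≤ (noiseLaw n σ).real (⋃ S ∈ Finset.univ.powersetCard s, tail S) := by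
        refine measureReal_mono (fun w ⟨β, hβ, hT⟩ ↦ ?_) (measure_ne_top _ _)
        obtain ⟨S, hS, hcard⟩ := Finset.exists_superset_card_eq hβ (by simpa using hs)
        simp only [Set.mem_iUnion, Finset.mem_powersetCard_univ]
        exact ⟨S, hcard, hT.trans_le
          (two_mul_sum_sub_sqNorm_le (fun j hj ↦ hS (by simpa using hj)) w)⟩
    _ ≤ ∑ S ∈ Finset.univ.powersetCard s, (noiseLaw n σ).real (tail S) :=
        measureReal_biUnion_finset_le _ _
    _ ≤ ∑ S ∈ (Finset.univ : Finset (Fin p)).powersetCard s,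
          2 ^ s * Real.exp (-(3 / 8 * T)) := by
        refine Finset.sum_le_sum fun S hS ↦
          (noiseLaw_real_lt_norm_sq_orthogonalProjectionOnto_le _ T).trans ?_
        gcongr
        · norm_num
        · exact (finrank_columnSpan_le X S).trans_eq (Finset.mem_powersetCard_univ.1 hS)
    _ = p.choose s * (2 ^ s * Real.exp (-(3 / 8 * T))) := by simp

end NoiseLaw

/-! ### Maurey's empirical method -/

-- The conclusion is the mean of `B` at `v` plus the sum of `m` independent copies of `z`, where `z`
-- takes the value `z j` with probability `a j`.
lemma nonneg_mean_of_forall_nonneg {E ι : Type*} [AddCommGroup E] [Module ℝ E] [Fintype ι]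
    {B : LinearMap.BilinForm ℝ E} (hB : B.IsSymm) {a : ι → ℝ} (ha : ∀ j, 0 ≤ a j)
    (ha1 : ∑ j, a j = 1) {z : ι → E} {x : E} (hx : ∑ j, a j • z j = x) (m : ℕ) (v : E)
    (h : ∀ f : Fin m → ι, 0 ≤ B (v + ∑ l, z (f l)) (v + ∑ l, z (f l))) :
    0 ≤ B v v + 2 * m * B v x + m * ∑ j, a j * B (z j) (z j) + m * (m - 1) * B x x := by
  induction m generalizing v with
  | zero => simpa using h Fin.elim0
  | succ m ih =>
    have hright (y : E) : ∑ j, a j * B y (z j) = B y x := by simp [← hx]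
    have hleft : ∑ j, a j * B (z j) x = B x x := by
      simpa only [← hB.eq x, RingHom.id_apply] using hright x
    set D := ∑ j, a j * B (z j) (z j) with hD
    have hstep (j : ι) : 0 ≤ a j * (B v v + 2 * B v (z j) + B (z j) (z j) +
        2 * m * (B v x + B (z j) x) + m * D + m * (m - 1) * B x x) := by
      refine mul_nonneg (ha j) ((ih (v + z j) fun f ↦ ?_).trans_eq ?_)
      · simpa [Fin.sum_univ_succ, add_assoc] using h (Fin.cons j f)
      · simp only [map_add, LinearMap.add_apply, ← hB.eq v (z j)]
        ring
    calc (0 : ℝ) ≤ _ := Finset.sum_nonneg fun j _ ↦ hstep j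
      _ = (∑ j, a j) * (B v v + 2 * m * B v x + m * D + m * (m - 1) * B x x) +
          2 * (∑ j, a j * B v (z j)) + (∑ j, a j * B (z j) (z j)) +
          2 * m * ∑ j, a j * B (z j) x := by
        simp only [Finset.sum_mul, Finset.mul_sum, ← Finset.sum_add_distrib]
        exact Finset.sum_congr rfl fun j _ ↦ by ring
      _ = _ := by
        rw [ha1, hright, hleft, ← hD]
        push_cast
        ring

/-- The sum of `m` signed standard basis vectors, with repetitions; the sign is `+` for `true`. -/
def atom {p m : ℕ} (f : Fin m → Fin p × Bool) : Fin p → ℝ :=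
  ∑ l, Pi.single (f l).1 (if (f l).2 then 1 else -1)

lemma abs_smul_single_sign {p : ℕ} (x : Fin p → ℝ) (j : Fin p) :
    |x j| • (Pi.single j (if 0 ≤ x j then 1 else -1) : Fin p → ℝ) = Pi.single j (x j) := by
  rw [← Pi.single_smul, smul_eq_mul]
  congr 1
  split_ifs with h
  · rw [abs_of_nonneg h, mul_one]
  · rw [abs_of_neg (not_le.1 h), mul_neg_one, neg_neg]

section Atom

variable {p m : ℕ} {B : LinearMap.BilinForm ℝ (Fin p → ℝ)} {D : ℝ}

lemma nonneg_of_forall_atom_nonneg_of_sum_abs_eq_one (hB : B.IsSymm)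
    (hD : ∀ j, B (Pi.single j 1) (Pi.single j 1) ≤ D)
    (h : ∀ f : Fin (m + 1) → Fin p × Bool, 0 ≤ B (atom f) (atom f)) {x : Fin p → ℝ}
    (hx : ∑ j, |x j| = 1) : 0 ≤ m * B x x + D := by
  let z (j : Fin p) : Fin p → ℝ := Pi.single j (if 0 ≤ x j then 1 else -1)
  have hxz : ∑ j, |x j| • z j = x := by
    simp only [z, abs_smul_single_sign, Finset.univ_sum_single]
  have hz (j : Fin p) : B (z j) (z j) ≤ D := by
    have hzj : z j = (if 0 ≤ x j then (1 : ℝ) else -1) • Pi.single j 1 := by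
      simp only [z, ← Pi.single_smul, smul_eq_mul, mul_one]
    rw [hzj]
    split_ifs <;> simpa using hD j
  have hmean : ∑ j, |x j| * B (z j) (z j) ≤ D := by
    calc _ ≤ ∑ j, |x j| * D := by gcongr with j; exact hz j
      _ = D := by rw [← Finset.sum_mul, hx, one_mul]
  have hnonneg := nonneg_mean_of_forall_nonneg hB (fun j ↦ abs_nonneg (x j)) hx hxz (m + 1) 0
    fun f ↦ by simpa [atom, z] using h fun l ↦ (f l, decide (0 ≤ x (f l)))
  simp only [map_zero, LinearMap.zero_apply, mul_zero, zero_add] at hnonneg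
  push_cast at hnonneg
  nlinarith

lemma nonneg_of_forall_atom_nonneg (hB : B.IsSymm)
    (hD : ∀ j, B (Pi.single j 1) (Pi.single j 1) ≤ D)
    (h : ∀ f : Fin (m + 1) → Fin p × Bool, 0 ≤ B (atom f) (atom f)) (x : Fin p → ℝ) :
    0 ≤ m * B x x + D * (∑ j, |x j|) ^ 2 := by
  set N := ∑ j, |x j| with hN
  have hN0 : 0 ≤ N := Finset.sum_nonneg fun _ _ ↦ abs_nonneg _
  rcases hN0.eq_or_lt with h0 | hpos
  · have hx : x = 0 := by
      ext j
      simpa using (Finset.sum_eq_zero_iff_of_nonneg fun j _ ↦ abs_nonneg (x j)).1 h0.symm j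
        (Finset.mem_univ _)
    simp [hx, ← h0]
  · have hunit : ∑ j, |(N⁻¹ • x) j| = 1 := by
      simp only [Pi.smul_apply, smul_eq_mul, abs_mul, abs_of_pos (inv_pos.2 hpos)]
      rw [← Finset.mul_sum, ← hN, inv_mul_cancel₀ hpos.ne']
    have hscale : B (N⁻¹ • x) (N⁻¹ • x) = N⁻¹ ^ 2 * B x x := by
      simp only [map_smul, LinearMap.smul_apply, smul_eq_mul]
      ring
    have hnonneg := nonneg_of_forall_atom_nonneg_of_sum_abs_eq_one hB hD h hunit
    rw [hscale] at hnonneg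
    calc 0 ≤ N ^ 2 * (m * (N⁻¹ ^ 2 * B x x) + D) := by positivity
      _ = m * B x x + D * N ^ 2 := by field_simp

end Atom

/-! ### Conditioning of the design on sparse vectors -/

/-- The bilinear form of the quadratic form `r ‖X x‖² + t ‖x‖²`, to which Maurey's method is applied
in order to compare `‖X x‖²` and `‖x‖²`. -/
noncomputable def designForm {n p : ℕ} (X : Design n p) (r t : ℝ) :
    LinearMap.BilinForm ℝ (Fin p → ℝ) :=
  LinearMap.mk₂ ℝ
    (fun x y ↦ r * ∑ a, applyDesign X x a * applyDesign X y a + t * ∑ j, x j * y j)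
    (fun x y z ↦ by
      simp only [applyDesign, Pi.add_apply, mul_add, add_mul, Finset.sum_add_distrib]
      ring)
    (fun c x y ↦ by
      simp only [applyDesign_smul, Pi.smul_apply, smul_eq_mul, mul_assoc, ← Finset.mul_sum]
      ring)
    (fun x y z ↦ by
      simp only [applyDesign, Pi.add_apply, mul_add, Finset.sum_add_distrib]
      ring)
    (fun c x y ↦ by
      simp only [applyDesign_smul, Pi.smul_apply, smul_eq_mul, mul_left_comm _ c, ← Finset.mul_sum]
      ring)

lemma designForm_self {n p : ℕ} (X : Design n p) (r t : ℝ) (x : Fin p → ℝ) :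
    designForm X r t x x = r * sqNorm (applyDesign X x) + t * sqNorm x := by
  simp only [designForm, LinearMap.mk₂_apply, sqNorm, sq]

lemma designForm_isSymm {n p : ℕ} (X : Design n p) (r t : ℝ) : (designForm X r t).IsSymm :=
  ⟨fun x y ↦ by
    simp only [designForm, LinearMap.mk₂_apply]
    simp_rw [fun a ↦ mul_comm (applyDesign X x a), fun j ↦ mul_comm (x j)]⟩

lemma sqNorm_single {p : ℕ} (j : Fin p) : sqNorm (Pi.single j 1 : Fin p → ℝ) = 1 := by
  simp [sqNorm, Pi.single_apply]

lemma sum_abs_single {p : ℕ} (j : Fin p) : ∑ l, |(Pi.single j 1 : Fin p → ℝ) l| = 1 := by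
  rw [Finset.sum_eq_single j] <;> simp +contextual

lemma sq_sum_abs_le_card_mul_sqNorm {p : ℕ} (S : Finset (Fin p)) (x : Fin p → ℝ) :
    (∑ j ∈ S, |x j|) ^ 2 ≤ S.card * sqNorm x := by
  refine sq_sum_le_card_mul_sum_sq.trans ?_
  gcongr
  simp_rw [sq_abs]
  exact Finset.sum_le_univ_sum_of_nonneg fun j ↦ sq_nonneg (x j)

lemma sq_sum_abs_le_hammingNorm_mul_sqNorm {p : ℕ} (x : Fin p → ℝ) :
    (∑ j, |x j|) ^ 2 ≤ hammingNorm x * sqNorm x := by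
  have hsupp : ∑ j, |x j| = ∑ j with x j ≠ 0, |x j| :=
    (Finset.sum_filter_of_ne fun j _ h ↦ abs_ne_zero.1 h).symm
  rw [hsupp]
  exact sq_sum_abs_le_card_mul_sqNorm _ x

lemma sq_sum_abs_le_of_mem_reCone {p : ℕ} {S : Finset (Fin p)} {x : Fin p → ℝ}
    (hx : x ∈ reCone S) : (∑ j, |x j|) ^ 2 ≤ 16 * S.card * sqNorm x := by
  have hcone : ∑ j ∈ Sᶜ, |x j| ≤ 3 * ∑ j ∈ S, |x j| := hx
  have hsum : ∑ j, |x j| ≤ 4 * ∑ j ∈ S, |x j| := by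
    rw [← Finset.sum_add_sum_compl S fun j ↦ |x j|]
    linarith
  have h0 : 0 ≤ ∑ j, |x j| := Finset.sum_nonneg fun _ _ ↦ abs_nonneg _
  calc (∑ j, |x j|) ^ 2 ≤ (4 * ∑ j ∈ S, |x j|) ^ 2 := pow_le_pow_left₀ h0 hsum 2
    _ = 16 * (∑ j ∈ S, |x j|) ^ 2 := by ring
    _ ≤ 16 * (S.card * sqNorm x) := by gcongr; exact sq_sum_abs_le_card_mul_sqNorm S x
    _ = 16 * S.card * sqNorm x := by ring

/-- The design distorts the squared norms of the sums of `m` signed basis vectors, rescaled by `n`,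
by factors between `1 / 2` and `2 κ`. This is a finite family of conditions, so that a union bound
shows it for random designs, and it controls the design on all approximately sparse vectors. -/
def WellConditionedOnAtoms {n p : ℕ} (κ : ℝ) (m : ℕ) (X : Design n p) : Prop :=
  ∀ f : Fin m → Fin p × Bool, 1 / 2 * n * sqNorm (atom f) ≤ sqNorm (applyDesign X (atom f)) ∧
    sqNorm (applyDesign X (atom f)) ≤ 2 * κ * n * sqNorm (atom f)

section WellConditionedOnAtoms

variable {n p m k M : ℕ} {κ : ℝ} {X : Design n p}

lemma WellConditionedOnAtoms.mul_sqNorm_applyDesign_le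
    (hX : WellConditionedOnAtoms κ (m + 1) X) (x : Fin p → ℝ) :
    m * sqNorm (applyDesign X x) ≤ 2 * κ * n * (m * sqNorm x + (∑ j, |x j|) ^ 2) := by
  have hdiag (j : Fin p) :
      designForm X (-1) (2 * κ * n) (Pi.single j 1) (Pi.single j 1) ≤ 2 * κ * n := by
    rw [designForm_self, sqNorm_single]
    linarith [sqNorm_nonneg (applyDesign X (Pi.single j 1))]
  have h := nonneg_of_forall_atom_nonneg (m := m) (designForm_isSymm X (-1) (2 * κ * n)) hdiag
    (fun f ↦ by rw [designForm_self]; linarith [(hX f).2]) x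
  rw [designForm_self] at h
  linarith

lemma WellConditionedOnAtoms.sqNorm_applyDesign_single_le (hκ : 0 ≤ κ) (hm : 1 ≤ m)
    (hX : WellConditionedOnAtoms κ (m + 1) X) (j : Fin p) :
    sqNorm (applyDesign X (Pi.single j 1)) ≤ 4 * κ * n := by
  have hm' : (1 : ℝ) ≤ m := by exact_mod_cast hm
  have h := hX.mul_sqNorm_applyDesign_le (Pi.single j 1)
  rw [sqNorm_single, sum_abs_single] at h
  have h0 : 0 ≤ κ * n := by positivity
  refine le_of_mul_le_mul_left (a := (m : ℝ)) ?_ (by linarith)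
  nlinarith

lemma WellConditionedOnAtoms.le_mul_sqNorm_applyDesign (hκ : 0 ≤ κ) (hm : 1 ≤ m)
    (hX : WellConditionedOnAtoms κ (m + 1) X) (x : Fin p → ℝ) :
    n * (1 / 2 * m * sqNorm x - 4 * κ * (∑ j, |x j|) ^ 2) ≤ m * sqNorm (applyDesign X x) := by
  have hdiag (j : Fin p) :
      designForm X 1 (-(1 / 2 * n)) (Pi.single j 1) (Pi.single j 1) ≤ 4 * κ * n := by
    have : (0 : ℝ) ≤ n := n.cast_nonneg
    rw [designForm_self, sqNorm_single]
    linarith [hX.sqNorm_applyDesign_single_le hκ hm j]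
  have h := nonneg_of_forall_atom_nonneg (m := m) (designForm_isSymm X 1 (-(1 / 2 * n))) hdiag
    (fun f ↦ by rw [designForm_self]; linarith [(hX f).1]) x
  rw [designForm_self] at h
  linarith

lemma WellConditionedOnAtoms.quarter_mul_sqNorm_le (hκ : 0 ≤ κ) (hk : 1 ≤ k)
    (hM1 : 1 ≤ M) (hM : 256 * κ ≤ M) (hX : WellConditionedOnAtoms κ (k * M + 1) X)
    {x : Fin p → ℝ} (hx : (∑ j, |x j|) ^ 2 ≤ 16 * k * sqNorm x) :
    1 / 4 * n * sqNorm x ≤ sqNorm (applyDesign X x) := by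
  have hkM : 1 ≤ k * M := Nat.mul_pos hk hM1
  have hpos : (0 : ℝ) < ((k * M : ℕ) : ℝ) := by exact_mod_cast hkM
  have hcross : k * sqNorm x * (256 * κ) ≤ k * sqNorm x * M :=
    mul_le_mul_of_nonneg_left hM (mul_nonneg k.cast_nonneg (sqNorm_nonneg x))
  refine le_of_mul_le_mul_left ?_ hpos
  calc ((k * M : ℕ) : ℝ) * (1 / 4 * n * sqNorm x)
      ≤ n * (1 / 2 * (k * M : ℕ) * sqNorm x - 4 * κ * (16 * k * sqNorm x)) := by
        have : (0 : ℝ) ≤ n := n.cast_nonneg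
        push_cast
        nlinarith
    _ ≤ n * (1 / 2 * (k * M : ℕ) * sqNorm x - 4 * κ * (∑ j, |x j|) ^ 2) := by gcongr
    _ ≤ (k * M : ℕ) * sqNorm (applyDesign X x) := hX.le_mul_sqNorm_applyDesign hκ hkM x

lemma WellConditionedOnAtoms.isNormalized {K : ℝ} (hK : 2 < K) (hk : 1 ≤ k)
    (hM1 : 1 ≤ M) (hM : 2 * (K + 2) / (K - 2) ≤ M)
    (hX : WellConditionedOnAtoms ((K + 2) / 4) (k * M + 1) X) : IsNormalized K X k := by
  intro x hx
  have hpos : (0 : ℝ) < ((k * M : ℕ) : ℝ) := by exact_mod_cast Nat.mul_pos hk hM1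
  have hx0 := sqNorm_nonneg x
  have hl1 : (∑ j, |x j|) ^ 2 ≤ 2 * k * sqNorm x := by
    refine (sq_sum_abs_le_hammingNorm_mul_sqNorm x).trans (mul_le_mul_of_nonneg_right ?_ hx0)
    exact_mod_cast hx
  rw [div_le_iff₀ (by linarith)] at hM
  have hcross : k * sqNorm x * (2 * (K + 2)) ≤ k * sqNorm x * (M * (K - 2)) :=
    mul_le_mul_of_nonneg_left hM (by positivity)
  refine div_le_of_le_mul₀ n.cast_nonneg (by nlinarith) (le_of_mul_le_mul_left ?_ hpos)
  calc (k * M : ℕ) * sqNorm (applyDesign X x)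
      ≤ 2 * ((K + 2) / 4) * n * ((k * M : ℕ) * sqNorm x + (∑ j, |x j|) ^ 2) :=
        hX.mul_sqNorm_applyDesign_le x
    _ ≤ 2 * ((K + 2) / 4) * n * ((k * M : ℕ) * sqNorm x + 2 * k * sqNorm x) := by gcongr
    _ ≤ (k * M : ℕ) * (K * sqNorm x * n) := by
        have : (0 : ℝ) ≤ n := n.cast_nonneg
        push_cast
        nlinarith

lemma bddAbove_restrictedEigenvalue (hk : 1 ≤ k) (hkp : k ≤ p) :
    BddAbove {γ : ℝ | ∀ S : Finset (Fin p), S.card = k → ∀ β ∈ reCone S,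
      γ * sqNorm β ≤ sqNorm (applyDesign X β) / n} := by
  obtain ⟨S, -, hS⟩ := Finset.exists_superset_card_eq (s := (∅ : Finset (Fin p))) (n := k)
    (by simp) (by simpa using hkp)
  obtain ⟨j, hj⟩ : S.Nonempty := Finset.card_pos.1 (by omega)
  refine ⟨sqNorm (applyDesign X (Pi.single j 1)) / n, fun γ hγ ↦ ?_⟩
  have hcone : Pi.single j 1 ∈ reCone S := by
    have hout : ∑ l ∈ Sᶜ, |(Pi.single j 1 : Fin p → ℝ) l| = 0 := by
      refine Finset.sum_eq_zero fun l hl ↦ ?_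
      have hlj : l ≠ j := fun h ↦ Finset.mem_compl.1 hl (h ▸ hj)
      simp [hlj]
    exact hout.trans_le (by positivity)
  simpa only [sqNorm_single, mul_one] using hγ S hS _ hcone

lemma WellConditionedOnAtoms.quarter_le_restrictedEigenvalue (hκ : 0 ≤ κ) (hn : 0 < n)
    (hk : 1 ≤ k) (hkp : k ≤ p) (hM1 : 1 ≤ M) (hM : 256 * κ ≤ M)
    (hX : WellConditionedOnAtoms κ (k * M + 1) X) : 1 / 4 ≤ restrictedEigenvalue X k := by
  refine le_csSup (bddAbove_restrictedEigenvalue hk hkp) fun S hS β hβ ↦ ?_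
  rw [le_div_iff₀ (by exact_mod_cast hn)]
  have hl1 := sq_sum_abs_le_of_mem_reCone hβ
  rw [hS] at hl1
  linarith [hX.quarter_mul_sqNorm_le hκ hk hM1 hM hl1]

end WellConditionedOnAtoms

section RandomDesign

variable {n p : ℕ} {ν : Measure (Design n p)} [IsFiniteMeasure ν] {κ : ℝ}

lemma measureReal_sqNorm_applyDesign_lt_or_lt_le {v : Fin p → ℝ} {s : ℝ≥0}
    (hlow : sqNorm v ≤ (s : ℝ) ^ 2) (hupp : (s : ℝ) ^ 2 ≤ 2 * sqNorm v)
    (hs : MeasurePreserving (fun X ↦ applyDesign X v) ν (noiseLaw n s)) (hκ : 1 < κ) :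
    ν.real {X | sqNorm (applyDesign X v) < 1 / 2 * n * sqNorm v ∨
        2 * κ * n * sqNorm v < sqNorm (applyDesign X v)} ≤
      Real.exp (-(chiRate (1 / 2) * n)) + Real.exp (-(chiRate κ * n)) := by
  let small : Set (Fin n → ℝ) := {w | sqNorm w < 1 / 2 * n * s ^ 2}
  let large : Set (Fin n → ℝ) := {w | κ * n * s ^ 2 < sqNorm w}
  have hmeas : MeasurableSet (small ∪ large) :=
    (measurableSet_lt measurable_sqNorm measurable_const).union
      (measurableSet_lt measurable_const measurable_sqNorm)
  calc _ ≤ ν.real ((fun X ↦ applyDesign X v) ⁻¹' (small ∪ large)) := by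
        refine measureReal_mono ?_
        rintro X (hX | hX)
        · exact Or.inl (hX.trans_le (by gcongr))
        · refine Or.inr (lt_of_le_of_lt ?_ hX)
          calc κ * n * s ^ 2 ≤ κ * n * (2 * sqNorm v) := by gcongr
            _ = 2 * κ * n * sqNorm v := by ring
    _ = (noiseLaw n s).real (small ∪ large) := hs.measureReal_preimage hmeas.nullMeasurableSet
    _ ≤ (noiseLaw n s).real small + (noiseLaw n s).real large := measureReal_union_le _ _
    _ ≤ _ := add_le_add (noiseLaw_real_sqNorm_lt_le (by norm_num) (by norm_num))
        (noiseLaw_real_lt_sqNorm_le hκ)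

lemma measureReal_not_wellConditionedOnAtoms_le
    (hν : ∀ v : Fin p → ℝ, ∃ s : ℝ≥0, sqNorm v ≤ (s : ℝ) ^ 2 ∧ (s : ℝ) ^ 2 ≤ 2 * sqNorm v ∧
      MeasurePreserving (fun X ↦ applyDesign X v) ν (noiseLaw n s)) (hκ : 1 < κ) (m : ℕ) :
    ν.real {X | ¬ WellConditionedOnAtoms κ m X} ≤
      (2 * p : ℝ) ^ m * (Real.exp (-(chiRate (1 / 2) * n)) + Real.exp (-(chiRate κ * n))) := by
  let bad (v : Fin p → ℝ) : Set (Design n p) :=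
    {X | sqNorm (applyDesign X v) < 1 / 2 * n * sqNorm v ∨
      2 * κ * n * sqNorm v < sqNorm (applyDesign X v)}
  have hcover : {X | ¬ WellConditionedOnAtoms κ m X} =
      ⋃ f : Fin m → Fin p × Bool, bad (atom f) := by
    ext X
    simp only [WellConditionedOnAtoms, bad, not_forall, not_and_or, not_le, Set.mem_iUnion,
      Set.mem_ofPred_eq]
  have hbad (f : Fin m → Fin p × Bool) : ν.real (bad (atom f)) ≤
      Real.exp (-(chiRate (1 / 2) * n)) + Real.exp (-(chiRate κ * n)) := by
    obtain ⟨s, hlow, hupp, hs⟩ := hν (atom f)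
    exact measureReal_sqNorm_applyDesign_lt_or_lt_le hlow hupp hs hκ
  calc _ ≤ ∑ f : Fin m → Fin p × Bool, ν.real (bad (atom f)) := by
        rw [hcover]
        exact measureReal_iUnion_fintype_le _
    _ ≤ ∑ _f : Fin m → Fin p × Bool,
          (Real.exp (-(chiRate (1 / 2) * n)) + Real.exp (-(chiRate κ * n))) :=
        Finset.sum_le_sum fun f _ ↦ hbad f
    _ = _ := by
        rw [Finset.sum_const, Finset.card_univ, nsmul_eq_mul]
        congr 1
        simp [mul_comm]

end RandomDesign

/-! ### Gaussian regression -/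

section MultivariateGaussian

variable {ι κ : Type*} [Fintype ι] [DecidableEq ι] {S : Matrix ι ι ℝ}

lemma map_sum_mul_multivariateGaussian (hS : S.PosSemidef) (μ : EuclideanSpace ℝ ι) (a : ι → ℝ) :
    (multivariateGaussian μ S).map (fun x ↦ ∑ j, x j * a j) =
      gaussianReal (∑ j, μ j * a j) (a ⬝ᵥ S.mulVec a).toNNReal := by
  have hinner : (fun x : EuclideanSpace ℝ ι ↦ ∑ j, x j * a j) = innerSL ℝ (WithLp.toLp 2 a) := by
    ext x
    simp [PiLp.inner_apply]
  rw [hinner, IsGaussian.map_eq_gaussianReal]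
  congr 1
  · rw [ContinuousLinearMap.integral_comp_id_comm IsGaussian.integrable_id]
    simp [PiLp.inner_apply]
  · congr 1
    rw [← covariance_self (by fun_prop), ← covarianceBilin_multivariateGaussian (μ := μ) hS
      (WithLp.toLp 2 a) (WithLp.toLp 2 a), covarianceBilin_apply_eq_cov IsGaussian.memLp_two_id]
    rfl

variable [Fintype κ] {s : κ → ι} {i : ι} {b : κ → ℝ}

lemma hasGaussianLaw_prodMk_residual (μ : EuclideanSpace ℝ ι) :
    HasGaussianLaw (fun x : EuclideanSpace ℝ ι ↦
      ((fun j ↦ x (s j)), fun _ : Unit ↦ x i - ∑ j, x (s j) * b j))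
      (multivariateGaussian μ S) := by
  let Φ : EuclideanSpace ℝ ι →L[ℝ] (κ → ℝ) × (Unit → ℝ) :=
    (ContinuousLinearMap.pi fun j ↦ EuclideanSpace.proj (s j)).prod
      (ContinuousLinearMap.pi fun _ ↦ EuclideanSpace.proj i -
        ∑ j, b j • EuclideanSpace.proj (s j))
  have hΦ (x : EuclideanSpace ℝ ι) :
      ((fun j ↦ x (s j)), fun _ : Unit ↦ x i - ∑ j, x (s j) * b j) = Φ x := by
    ext <;> simp [Φ, mul_comm]
  simp_rw [hΦ]
  exact IsGaussian.hasGaussianLaw_id.map_fun Φ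

lemma indepFun_residual_of_normal_equations (hS : S.PosSemidef) (μ : EuclideanSpace ℝ ι)
    (h : ∀ j, ∑ l, S (s j) (s l) * b l = S (s j) i) :
    IndepFun (fun (x : EuclideanSpace ℝ ι) j ↦ x (s j)) (fun x ↦ x i - ∑ j, x (s j) * b j)
      (multivariateGaussian μ S) := by
  have hmem (l : ι) : MemLp (fun x : EuclideanSpace ℝ ι ↦ x l) 2 (multivariateGaussian μ S) :=
    (EuclideanSpace.proj l : EuclideanSpace ℝ ι →L[ℝ] ℝ).comp_memLp' IsGaussian.memLp_two_id
  refine IndepFun.comp (φ := id) (ψ := fun y : Unit → ℝ ↦ y ())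
    ((hasGaussianLaw_prodMk_residual μ).indepFun_of_covariance_eval fun j _ ↦ ?_)
    measurable_id (by fun_prop)
  rw [covariance_fun_sub_right (hmem _) (hmem _)
    (memLp_finsetSum _ fun l _ ↦ (hmem _).mul_const _),
    covariance_fun_sum_right (fun l ↦ (hmem _).mul_const _) (hmem _)]
  simp_rw [covariance_mul_const_right, covariance_eval_multivariateGaussian hS, h, sub_self]

end MultivariateGaussian

/-! ### The spiked covariance model -/

section SkipIndex

variable {d : ℕ} (i : Fin d)

/-- The vector `v_{-i}`: the `i`-th coordinate removed. -/
def dropCoord (v : Fin d → ℝ) : Fin (d - 1) → ℝ := fun j ↦ v (skipIndex i j)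

lemma skipIndex_ne (j : Fin (d - 1)) : skipIndex i j ≠ i := by
  simp only [skipIndex, ne_eq, Fin.ext_iff]
  split_ifs <;> omega

lemma skipIndex_injective : Function.Injective (skipIndex i) := by
  intro j l h
  simp only [skipIndex, Fin.ext_iff] at h ⊢
  split_ifs at h <;> omega

lemma skipIndex_eq_succAbove {d : ℕ} (i : Fin (d + 1)) : skipIndex i = i.succAbove := by
  ext j
  simp only [skipIndex, Fin.succAbove, Fin.lt_def, Fin.val_castSucc]
  split_ifs <;> simp

lemma sum_eq_add_sum_skipIndex (f : Fin d → ℝ) :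
    ∑ j, f j = f i + ∑ j, f (skipIndex i j) := by
  obtain _ | d := d
  · exact i.elim0
  rw [Fin.sum_univ_succAbove f i, ← skipIndex_eq_succAbove]
  rfl

lemma exists_dropCoord_eq (t : ℝ) (v : Fin (d - 1) → ℝ) :
    ∃ a : Fin d → ℝ, a i = t ∧ dropCoord i a = v := by
  obtain _ | d := d
  · exact i.elim0
  refine ⟨i.insertNth t v, by simp, ?_⟩
  ext j
  rw [dropCoord, skipIndex_eq_succAbove, Fin.insertNth_apply_succAbove]

lemma sqNorm_eq_sq_add_sqNorm_dropCoord (v : Fin d → ℝ) :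
    sqNorm v = v i ^ 2 + sqNorm (dropCoord i v) :=
  sum_eq_add_sum_skipIndex i fun j ↦ v j ^ 2

end SkipIndex

section SpikedCov

variable {d : ℕ} {θ : ℝ} (u : Fin d → ℝ) (i : Fin d)

lemma posSemidef_spikedCov (hθ : 0 ≤ θ) : (spikedCov θ u).PosSemidef := by
  have h := Matrix.posSemidef_vecMulVec_self_star u
  rw [star_trivial] at h
  exact Matrix.PosSemidef.one.add (h.smul hθ)

lemma spikedCov_apply (θ : ℝ) (i j : Fin d) :
    spikedCov θ u i j = (if i = j then 1 else 0) + θ * (u i * u j) := by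
  simp [spikedCov, Matrix.one_apply, Matrix.vecMulVec_apply]

lemma dotProduct_spikedCov_mulVec (θ : ℝ) (a : Fin d → ℝ) :
    a ⬝ᵥ (spikedCov θ u).mulVec a = sqNorm a + θ * (u ⬝ᵥ a) ^ 2 := by
  have hmulVec : (spikedCov θ u).mulVec a = a + (θ * (u ⬝ᵥ a)) • u := by
    rw [spikedCov, Matrix.add_mulVec, Matrix.one_mulVec, Matrix.smul_mulVec,
      Matrix.vecMulVec_mulVec, op_smul_eq_smul, smul_smul]
  have hself : a ⬝ᵥ a = sqNorm a := Finset.sum_congr rfl fun j _ ↦ (sq (a j)).symm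
  rw [hmulVec, dotProduct_add, dotProduct_smul, smul_eq_mul, dotProduct_comm a u, hself]
  ring

lemma map_mul_add_sum_skipIndex_multivariateGaussian (hθ : 0 ≤ θ) (t : ℝ)
    (v : Fin (d - 1) → ℝ) :
    (multivariateGaussian 0 (spikedCov θ u)).map
        (fun x ↦ x i * t + ∑ j, x (skipIndex i j) * v j) =
      gaussianReal 0
        (t ^ 2 + sqNorm v + θ * (u i * t + dropCoord i u ⬝ᵥ v) ^ 2).toNNReal := by
  obtain ⟨a, rfl, rfl⟩ := exists_dropCoord_eq i t v
  have hsum (x : Fin d → ℝ) :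
      x i * a i + ∑ j, x (skipIndex i j) * dropCoord i a j = ∑ j, x j * a j :=
    (sum_eq_add_sum_skipIndex i fun j ↦ x j * a j).symm
  simp_rw [hsum]
  rw [map_sum_mul_multivariateGaussian (posSemidef_spikedCov u hθ), dotProduct_spikedCov_mulVec,
    sqNorm_eq_sq_add_sqNorm_dropCoord i a, dotProduct, ← hsum u]
  simp [dotProduct, dropCoord]

/-- The coefficients of the regression of coordinate `i` on the others under `N(0, I + θ u uᵀ)`. -/
noncomputable def regCoef (θ : ℝ) (u : Fin d → ℝ) (i : Fin d) : Fin (d - 1) → ℝ :=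
  (θ * u i / (1 + θ * sqNorm (dropCoord i u))) • dropCoord i u

/-- The standard deviation of the residual of coordinate `i`, after regression on the others, under
`N(0, I + θ u uᵀ)`. -/
noncomputable def residualSd (θ : ℝ) (u : Fin d → ℝ) (i : Fin d) : ℝ≥0 :=
  NNReal.sqrt (1 + θ * u i ^ 2 / (1 + θ * sqNorm (dropCoord i u))).toNNReal

lemma one_add_mul_sqNorm_dropCoord_pos (hθ : 0 ≤ θ) : 0 < 1 + θ * sqNorm (dropCoord i u) := by
  have := sqNorm_nonneg (dropCoord i u)
  positivity

lemma residualSd_sq (hθ : 0 ≤ θ) :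
    (residualSd θ u i : ℝ) ^ 2 = 1 + θ * u i ^ 2 / (1 + θ * sqNorm (dropCoord i u)) := by
  have := one_add_mul_sqNorm_dropCoord_pos u i hθ
  rw [residualSd, ← NNReal.coe_pow, NNReal.sq_sqrt, Real.coe_toNNReal]
  positivity

lemma one_le_residualSd_sq (hθ : 0 ≤ θ) : 1 ≤ (residualSd θ u i : ℝ) ^ 2 := by
  have := one_add_mul_sqNorm_dropCoord_pos u i hθ
  rw [residualSd_sq u i hθ, le_add_iff_nonneg_right]
  positivity

lemma residualSd_pos (hθ : 0 ≤ θ) : 0 < residualSd θ u i := by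
  have h : 0 < (residualSd θ u i : ℝ) ^ 2 := zero_lt_one.trans_le (one_le_residualSd_sq u i hθ)
  exact_mod_cast pow_pos_iff two_ne_zero |>.1 h

lemma residualSd_sq_le_two {u : Fin d → ℝ} (hθ : 0 ≤ θ) (hθ1 : θ ≤ 1) (hu : sqNorm u = 1) :
    (residualSd θ u i : ℝ) ^ 2 ≤ 2 := by
  have hsplit := sqNorm_eq_sq_add_sqNorm_dropCoord i u
  have hdrop := sqNorm_nonneg (dropCoord i u)
  have hratio : θ * u i ^ 2 / (1 + θ * sqNorm (dropCoord i u)) ≤ 1 := by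
    rw [div_le_one (one_add_mul_sqNorm_dropCoord_pos u i hθ)]
    nlinarith [sq_nonneg (u i), mul_nonneg hθ hdrop]
  linarith [residualSd_sq u i hθ]

/-- The law of `x_{-i}` for `x ∼ N(0, I + θ u uᵀ)`. -/
noncomputable def restLaw (θ : ℝ) (u : Fin d → ℝ) (i : Fin d) : Measure (Fin (d - 1) → ℝ) :=
  (multivariateGaussian 0 (spikedCov θ u)).map fun x j ↦ x (skipIndex i j)

instance : IsProbabilityMeasure (restLaw θ u i) :=
  Measure.isProbabilityMeasure_map (by fun_prop)

lemma spikedCov_normal_equations (hθ : 0 ≤ θ) (j : Fin (d - 1)) :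
    ∑ l, spikedCov θ u (skipIndex i j) (skipIndex i l) * regCoef θ u i l =
      spikedCov θ u (skipIndex i j) i := by
  have hpos := one_add_mul_sqNorm_dropCoord_pos u i hθ
  have hspike : ∑ l, θ * (u (skipIndex i j) * u (skipIndex i l)) * regCoef θ u i l =
      θ * u (skipIndex i j) * (θ * u i / (1 + θ * sqNorm (dropCoord i u))) *
        sqNorm (dropCoord i u) := by
    simp only [regCoef, sqNorm, dropCoord, Pi.smul_apply, smul_eq_mul, Finset.mul_sum]
    exact Finset.sum_congr rfl fun l _ ↦ by ring
  simp only [spikedCov_apply, (skipIndex_injective i).eq_iff, skipIndex_ne, add_mul, ite_mul,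
    one_mul, zero_mul, Finset.sum_add_distrib, Finset.sum_ite_eq, Finset.mem_univ, if_true,
    if_false, hspike]
  rw [regCoef, Pi.smul_apply, smul_eq_mul, dropCoord]
  field_simp
  ring

lemma map_residual (hθ : 0 ≤ θ) :
    (multivariateGaussian 0 (spikedCov θ u)).map
        (fun x ↦ x i - ∑ j, x (skipIndex i j) * regCoef θ u i j) =
      gaussianReal 0 (residualSd θ u i ^ 2) := by
  have hpos := one_add_mul_sqNorm_dropCoord_pos u i hθ
  have hneg : (fun x : EuclideanSpace ℝ (Fin d) ↦
      x i - ∑ j, x (skipIndex i j) * regCoef θ u i j) =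
      fun x ↦ x i * 1 + ∑ j, x (skipIndex i j) * (-regCoef θ u i) j := by
    simp [sub_eq_add_neg]
  have hdot : dropCoord i u ⬝ᵥ dropCoord i u = sqNorm (dropCoord i u) :=
    Finset.sum_congr rfl fun j _ ↦ (sq _).symm
  rw [hneg, map_mul_add_sum_skipIndex_multivariateGaussian u i hθ]
  congr 1
  ext
  rw [NNReal.coe_pow, residualSd_sq u i hθ, regCoef, ← neg_smul, sqNorm_smul, dotProduct_smul,
    hdot, smul_eq_mul, Real.coe_toNNReal]
  · field_simp
    ring
  · have := sqNorm_nonneg (dropCoord i u)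
    positivity

lemma measurePreserving_row_split (hθ : 0 ≤ θ) :
    MeasurePreserving (fun x : EuclideanSpace ℝ (Fin d) ↦
        ((fun j ↦ x (skipIndex i j)), x i - ∑ j, x (skipIndex i j) * regCoef θ u i j))
      (multivariateGaussian 0 (spikedCov θ u))
      ((restLaw θ u i).prod (gaussianReal 0 (residualSd θ u i ^ 2))) where
  measurable := by fun_prop
  map_eq := by
    rw [(indepFun_iff_map_prod_eq_prod_map_map (by fun_prop) (by fun_prop)).1
      (indepFun_residual_of_normal_equations (posSemidef_spikedCov u hθ) 0
        (spikedCov_normal_equations u i hθ)), map_residual u i hθ]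
    rfl

lemma measurePreserving_sample_split (n : ℕ) (hθ : 0 ≤ θ) :
    MeasurePreserving (fun x : Fin n → EuclideanSpace ℝ (Fin d) ↦
        (dropColumn (dataMatrix x) i,
          column (dataMatrix x) i - applyDesign (dropColumn (dataMatrix x) i) (regCoef θ u i)))
      (sampleLaw n d (spikedCov θ u))
      ((Measure.pi fun _ ↦ restLaw θ u i).prod (noiseLaw n (residualSd θ u i))) :=
  (measurePreserving_arrowProdEquivProdArrow _ _ (Fin n) (fun _ ↦ restLaw θ u i)
    (fun _ ↦ gaussianReal 0 (residualSd θ u i ^ 2))).comp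
    (measurePreserving_pi _ _ fun _ ↦ measurePreserving_row_split u i hθ)

lemma map_sum_mul_restLaw (hθ : 0 ≤ θ) (v : Fin (d - 1) → ℝ) :
    (restLaw θ u i).map (fun x ↦ ∑ j, x j * v j) =
      gaussianReal 0 (sqNorm v + θ * (dropCoord i u ⬝ᵥ v) ^ 2).toNNReal := by
  rw [restLaw, Measure.map_map (by fun_prop) (by fun_prop)]
  simpa [Function.comp_def] using map_mul_add_sum_skipIndex_multivariateGaussian u i hθ 0 v

lemma exists_measurePreserving_applyDesign_restLaw {u : Fin d → ℝ} (n : ℕ) (hθ : 0 ≤ θ)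
    (hθ1 : θ ≤ 1) (hu : sqNorm u = 1) (v : Fin (d - 1) → ℝ) :
    ∃ s : ℝ≥0, sqNorm v ≤ (s : ℝ) ^ 2 ∧ (s : ℝ) ^ 2 ≤ 2 * sqNorm v ∧
      MeasurePreserving (fun X : Design n (d - 1) ↦ applyDesign X v)
        (Measure.pi fun _ ↦ restLaw θ u i) (noiseLaw n s) := by
  have hv := sqNorm_nonneg v
  have hdrop : sqNorm (dropCoord i u) ≤ 1 := by
    linarith [sqNorm_eq_sq_add_sqNorm_dropCoord i u, sq_nonneg (u i)]
  have hcs : (dropCoord i u ⬝ᵥ v) ^ 2 ≤ sqNorm v :=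
    (Finset.sum_mul_sq_le_sq_mul_sq _ _ _).trans (mul_le_of_le_one_left hv hdrop)
  have hspike : θ * (dropCoord i u ⬝ᵥ v) ^ 2 ≤ sqNorm v :=
    (mul_le_of_le_one_left (sq_nonneg _) hθ1).trans hcs
  set V := (sqNorm v + θ * (dropCoord i u ⬝ᵥ v) ^ 2).toNNReal with hV
  have hs : ((NNReal.sqrt V : ℝ≥0) : ℝ) ^ 2 = sqNorm v + θ * (dropCoord i u ⬝ᵥ v) ^ 2 := by
    rw [← NNReal.coe_pow, NNReal.sq_sqrt, hV, Real.coe_toNNReal _ (by positivity)]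
  refine ⟨NNReal.sqrt V, ?_, ?_, ?_⟩
  · rw [hs]
    exact le_add_of_nonneg_right (by positivity)
  · linarith
  · refine measurePreserving_pi (fun _ : Fin n ↦ restLaw θ u i)
      (fun _ ↦ gaussianReal 0 (NNReal.sqrt V ^ 2)) (f := fun _ x ↦ ∑ j, x j * v j)
      fun _ ↦ ⟨by fun_prop, ?_⟩
    rw [NNReal.sq_sqrt, map_sum_mul_restLaw u i hθ]

end SpikedCov

lemma measureReal_prod_le_add {α β : Type*} [MeasurableSpace α] [MeasurableSpace β]
    {μ : Measure α} {ν : Measure β} [IsProbabilityMeasure μ] [IsProbabilityMeasure ν]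
    {A : Set (α × β)} (hA : MeasurableSet A) {N : Set α} {b : ℝ} (hb : 0 ≤ b)
    (h : ∀ x ∉ N, ν.real {y | (x, y) ∈ A} ≤ b) : (μ.prod ν).real A ≤ μ.real N + b := by
  let M := toMeasurable μ N
  have hslice (x : α) : ν (Prod.mk x ⁻¹' A) ≤ M.indicator 1 x + ENNReal.ofReal b := by
    by_cases hx : x ∈ M
    · rw [Set.indicator_of_mem hx]
      exact prob_le_one.trans le_self_add
    · refine le_trans ?_ le_add_self
      rw [← ofReal_measureReal]
      exact ENNReal.ofReal_le_ofReal (h x fun hN ↦ hx (subset_toMeasurable μ N hN))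
  refine ENNReal.toReal_le_of_le_ofReal (by positivity) ?_
  calc (μ.prod ν) A = ∫⁻ x, ν (Prod.mk x ⁻¹' A) ∂μ := Measure.prod_apply hA
    _ ≤ ∫⁻ x, M.indicator 1 x + ENNReal.ofReal b ∂μ := lintegral_mono hslice
    _ = μ N + ENNReal.ofReal b := by
        rw [lintegral_add_right _ measurable_const,
          lintegral_indicator_one (measurableSet_toMeasurable μ N), measure_toMeasurable]
        simp
    _ = ENNReal.ofReal (μ.real N + b) := by
        rw [ENNReal.ofReal_add measureReal_nonneg hb, ofReal_measureReal]

/-! ### Type I error -/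

/-- The decrease of the mean squared error of `y` achieved by the black box: the statistic `Q_i` for
an arbitrary regression instance. -/
noncomputable def fitGain (SLR : Solver) {n p : ℕ} (X : Design n p) (y : Fin n → ℝ) (k : ℕ) : ℝ :=
  sqNorm y / n - sqNorm (y - applyDesign X (SLR n p y X k)) / n

lemma measurable_applyDesign {n p : ℕ} :
    Measurable fun q : Design n p × (Fin p → ℝ) ↦ applyDesign q.1 q.2 := by
  unfold applyDesign
  fun_prop

lemma measurable_fitGain {SLR : Solver} {n p k : ℕ}
    (h : Measurable fun q : (Fin n → ℝ) × Design n p ↦ SLR n p q.1 q.2 k) :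
    Measurable fun q : Design n p × (Fin n → ℝ) ↦ fitGain SLR q.1 q.2 k := by
  have hfit : Measurable fun q : Design n p × (Fin n → ℝ) ↦
      applyDesign q.1 (SLR n p q.2 q.1 k) :=
    measurable_applyDesign.comp (measurable_fst.prodMk (h.comp measurable_swap))
  exact ((measurable_sqNorm.comp measurable_snd).div_const _).sub
    ((measurable_sqNorm.comp (measurable_snd.sub hfit)).div_const _)

lemma sqNorm_sub_sqNorm_sub {m : ℕ} (y v : Fin m → ℝ) :
    sqNorm y - sqNorm (y - v) = 2 * ∑ a, y a * v a - sqNorm v := by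
  simp only [sqNorm, Finset.mul_sum, ← Finset.sum_sub_distrib, Pi.sub_apply]
  exact Finset.sum_congr rfl fun a _ ↦ by ring

lemma noiseLaw_real_lt_fitGain_le {SLR : Solver} {n p k : ℕ} {X : Design n p} (hn : 0 < n)
    (hkp : k ≤ p) (hsparse : ∀ y, hammingNorm (SLR n p y X k) ≤ k) (σ : ℝ≥0) (T : ℝ) :
    (noiseLaw n σ).real {w | σ ^ 2 * T / n < fitGain SLR X w k} ≤
      p.choose k * (2 ^ k * Real.exp (-(3 / 8 * T))) := by
  refine le_trans (measureReal_mono fun w hw ↦ ?_)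
    (noiseLaw_real_exists_sparse_lt_le X hkp T)
  refine ⟨SLR n p w X k, hsparse w, ?_⟩
  rwa [Set.mem_ofPred_eq, fitGain, ← sub_div,
    div_lt_div_iff_of_pos_right (by exact_mod_cast hn), sqNorm_sub_sqNorm_sub] at hw

instance (n d : ℕ) (Γ : Matrix (Fin d) (Fin d) ℝ) : IsProbabilityMeasure (sampleLaw n d Γ) := by
  unfold sampleLaw
  infer_instance

lemma sampleLaw_real_le_add {n d : ℕ} {θ : ℝ} (hθ : 0 ≤ θ) (u : Fin d → ℝ) (i : Fin d)
    {A : Set (Design n (d - 1) × (Fin n → ℝ))} (hA : MeasurableSet A)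
    {N : Set (Design n (d - 1))} {b : ℝ} (hb : 0 ≤ b)
    (h : ∀ X ∉ N, (noiseLaw n (residualSd θ u i)).real
      {w | (X, applyDesign X (regCoef θ u i) + w) ∈ A} ≤ b) :
    (sampleLaw n d (spikedCov θ u)).real
      {x | (dropColumn (dataMatrix x) i, column (dataMatrix x) i) ∈ A} ≤
        (Measure.pi fun _ ↦ restLaw θ u i).real N + b := by
  have hm : Measurable fun q : Design n (d - 1) × (Fin n → ℝ) ↦
      (q.1, applyDesign q.1 (regCoef θ u i) + q.2) :=
    measurable_fst.prodMk
      ((measurable_applyDesign.comp (measurable_fst.prodMk measurable_const)).add measurable_snd)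
  have hprod := measureReal_prod_le_add (μ := Measure.pi fun _ ↦ restLaw θ u i) (hm hA) hb h
  rw [← (measurePreserving_sample_split u i n hθ).measureReal_preimage
    (hm hA).nullMeasurableSet] at hprod
  simpa only [← Set.preimage_comp, Function.comp_def, add_sub_cancel, Set.preimage,
    Set.mem_ofPred_eq] using hprod

lemma spikedCov_zero {d : ℕ} (u : Fin d → ℝ) : spikedCov 0 u = 1 := by
  simp [spikedCov]

lemma qTest_eq_one_iff (SLR : Solver) {n d : ℕ} (X : Design n d) (k : ℕ) :
    qTest SLR X k = 1 ↔ ∃ i : Fin d, qThreshold n d k < qStat SLR X k i := by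
  unfold qTest
  split_ifs with h <;> simp [h]

lemma qTest_eq_zero_iff (SLR : Solver) {n d : ℕ} (X : Design n d) (k : ℕ) :
    qTest SLR X k = 0 ↔ ∀ i : Fin d, qStat SLR X k i ≤ qThreshold n d k := by
  simp only [qTest, ite_eq_right_iff, one_ne_zero, imp_false, not_exists, not_lt]

section TypeI

variable {SLR : Solver} {n d k : ℕ}
  (hmeas : Measurable fun q : (Fin n → ℝ) × Design n (d - 1) ↦ SLR n (d - 1) q.1 q.2 k)
  (hsparse : ∀ y X, hammingNorm (SLR n (d - 1) y X k) ≤ k)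

include hmeas hsparse

lemma sampleLaw_one_real_qThreshold_lt_qStat_le (hn : 0 < n) (hkd : k ≤ d - 1) (i : Fin d) :
    (sampleLaw n d 1).real {x | qThreshold n d k < qStat SLR (dataMatrix x) k i} ≤
      (d - 1).choose k * (2 ^ k * Real.exp (-(3 / 8 * (13 * k * Real.log (d / k))))) := by
  rw [← spikedCov_zero (0 : Fin d → ℝ)]
  have hreg (X : Design n (d - 1)) : applyDesign X (regCoef 0 (0 : Fin d → ℝ) i) = 0 := by
    ext a
    simp [applyDesign, regCoef]
  have hsd : (residualSd 0 (0 : Fin d → ℝ) i : ℝ) ^ 2 = 1 := by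
    simp [residualSd_sq]
  have hslice (X : Design n (d - 1)) :
      (noiseLaw n (residualSd 0 (0 : Fin d → ℝ) i)).real
        {w | qThreshold n d k < fitGain SLR X (applyDesign X (regCoef 0 0 i) + w) k} ≤
          (d - 1).choose k * (2 ^ k * Real.exp (-(3 / 8 * (13 * k * Real.log (d / k))))) := by
    simpa only [hreg, zero_add, hsd, one_mul, qThreshold] using
      noiseLaw_real_lt_fitGain_le hn hkd (hsparse · X) (residualSd 0 0 i)
        (13 * k * Real.log (d / k))
  exact (sampleLaw_real_le_add le_rfl 0 i (A := {q | qThreshold n d k < fitGain SLR q.1 q.2 k})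
    (measurableSet_lt measurable_const (measurable_fitGain hmeas)) (N := ∅)
    (measureReal_nonneg.trans (hslice 0)) fun X _ ↦ hslice X).trans_eq
      (by rw [measureReal_empty, zero_add])

lemma typeIError_le_choose (hn : 0 < n) (hkd : k ≤ d - 1) :
    typeIError SLR n d k ≤
      d * ((d - 1).choose k * (2 ^ k * Real.exp (-(3 / 8 * (13 * k * Real.log (d / k)))))) := by
  have hunion : {x | qTest SLR (dataMatrix x) k = 1} =
      ⋃ i : Fin d, {x : Fin n → EuclideanSpace ℝ (Fin d) |
        qThreshold n d k < qStat SLR (dataMatrix x) k i} := by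
    ext x
    simp only [Set.mem_ofPred_eq, Set.mem_iUnion, qTest_eq_one_iff]
  rw [typeIError, hunion]
  refine (measureReal_iUnion_fintype_le _).trans ((Finset.sum_le_sum fun i _ ↦
    sampleLaw_one_real_qThreshold_lt_qStat_le hmeas hsparse hn hkd i).trans_eq ?_)
  rw [Finset.sum_const, Finset.card_univ, Fintype.card_fin, nsmul_eq_mul]

end TypeI

lemma choose_le_exp {m d k : ℕ} (hk : 1 ≤ k) (hd : 1 ≤ d) (hm : m ≤ d) :
    (m.choose k : ℝ) ≤ Real.exp (k * Real.log (d / k) + k) := by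
  have : (0 : ℝ) < k := by exact_mod_cast hk
  have : (0 : ℝ) < d := by exact_mod_cast hd
  calc (m.choose k : ℝ) ≤ (m : ℝ) ^ k / k.factorial := Nat.choose_le_pow_div k m
    _ ≤ (d : ℝ) ^ k / k.factorial := by gcongr
    _ = (d / k : ℝ) ^ k * ((k : ℝ) ^ k / k.factorial) := by
        rw [div_pow]
        field_simp
    _ ≤ (d / k : ℝ) ^ k * Real.exp k := by
        gcongr
        exact Real.pow_div_factorial_le_exp _ k.cast_nonneg k
    _ = _ := by
        rw [Real.exp_add, Real.exp_nat_mul, Real.exp_log (by positivity)]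

section Sizes

variable {d k : ℕ}

lemma two_mul_add_one_le_of_exp_one_mul_le (hk : 1 ≤ k) (hd : Real.exp 1 * k ≤ d) :
    2 * k + 1 ≤ d := by
  have hexp : (2.7 : ℝ) * k ≤ Real.exp 1 * k := by
    gcongr
    linarith [Real.exp_one_gt_d9]
  have hle : 27 * k ≤ 10 * d := by
    have : (27 * k : ℝ) ≤ 10 * d := by linarith
    exact_mod_cast this
  omega

lemma one_le_log_div (hk : 1 ≤ k) (hd : Real.exp 1 * k ≤ d) : 1 ≤ Real.log (d / k) := by
  have hk' : (0 : ℝ) < k := by exact_mod_cast hk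
  have hexp : Real.exp 1 ≤ d / k := (le_div_iff₀ hk').2 hd
  exact (Real.le_log_iff_exp_le ((Real.exp_pos 1).trans_le hexp)).2 hexp

lemma log_le_mul_log_div (hk : 1 ≤ k) (hd : Real.exp 1 * k ≤ d) :
    Real.log d ≤ k * Real.log (d / k) := by
  have hk' : (1 : ℝ) ≤ k := by exact_mod_cast hk
  have hd' : (0 : ℝ) < d := lt_of_lt_of_le (by positivity) hd
  have hlog := one_le_log_div hk hd
  have hsplit : Real.log (d / k) = Real.log d - Real.log k :=
    Real.log_div hd'.ne' (by positivity)
  have hlogk := Real.log_le_sub_one_of_pos (by positivity : (0 : ℝ) < k)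
  nlinarith

lemma log_div_le_log (hk : 1 ≤ k) (hd : 1 ≤ d) : Real.log (d / k) ≤ Real.log d := by
  have hk' : (1 : ℝ) ≤ k := by exact_mod_cast hk
  have hd' : (1 : ℝ) ≤ d := by exact_mod_cast hd
  exact Real.log_le_log (by positivity) (div_le_self (by linarith) hk')

lemma mul_log_le_log_div_of_le_rpow {ε : ℝ} (hk : 1 ≤ k) (hd : 1 ≤ d)
    (h : (k : ℝ) ≤ (d : ℝ) ^ (1 - ε)) : ε * Real.log d ≤ Real.log (d / k) := by
  have hk' : (0 : ℝ) < k := by exact_mod_cast hk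
  have hd' : (0 : ℝ) < d := by exact_mod_cast hd
  have hlog := Real.log_le_log hk' h
  rw [Real.log_rpow hd'] at hlog
  rw [Real.log_div hd'.ne' hk'.ne']
  linarith

lemma log_sub_one_le_log : Real.log (d - 1 : ℕ) ≤ Real.log d := by
  obtain hd | hd := Nat.eq_zero_or_pos (d - 1)
  · simpa [hd] using Real.log_natCast_nonneg d
  · exact Real.log_le_log (by exact_mod_cast hd) (by exact_mod_cast Nat.sub_le d 1)

lemma log_le_two_mul_log_sub_one (hd : 3 ≤ d) : Real.log d ≤ 2 * Real.log (d - 1 : ℕ) := by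
  have hsq : d ≤ (d - 1) ^ 2 := by
    obtain ⟨e, rfl⟩ := Nat.exists_eq_add_of_le' hd
    rw [show e + 3 - 1 = e + 2 by omega]
    nlinarith
  rw [← Nat.cast_two, ← Real.log_pow]
  exact Real.log_le_log (by exact_mod_cast (by omega : 0 < d)) (by exact_mod_cast hsq)

lemma mul_choose_mul_exp_le (hk : 1 ≤ k) (hd : Real.exp 1 * k ≤ d) :
    d * ((d - 1).choose k * (2 ^ k * Real.exp (-(3 / 8 * (13 * k * Real.log (d / k)))))) ≤
      Real.exp (-(1 / 2 * (k * Real.log (d / k)))) := by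
  have hk' : (1 : ℝ) ≤ k := by exact_mod_cast hk
  have hd' : (0 : ℝ) < d := lt_of_lt_of_le (by positivity) hd
  have hlog := one_le_log_div hk hd
  have hlogd := log_le_mul_log_div hk hd
  have htwo : (2 : ℝ) ^ k ≤ Real.exp k := by
    rw [← mul_one (k : ℝ), Real.exp_nat_mul]
    gcongr
    linarith [Real.exp_one_gt_d9]
  calc _ ≤ Real.exp (Real.log d) * (Real.exp (k * Real.log (d / k) + k) *
        (Real.exp k * Real.exp (-(3 / 8 * (13 * k * Real.log (d / k)))))) := by
        rw [Real.exp_log hd']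
        gcongr
        exact choose_le_exp hk (by exact_mod_cast hd') (Nat.sub_le d 1)
    _ ≤ _ := by
        rw [← Real.exp_add, ← Real.exp_add, ← Real.exp_add]
        apply Real.exp_le_exp.2
        nlinarith

lemma natCast_pow_eq_exp (hd : 1 ≤ d) (m : ℕ) : (d : ℝ) ^ m = Real.exp (m * Real.log d) := by
  rw [Real.exp_nat_mul, Real.exp_log (by exact_mod_cast hd)]

lemma choose_two_mul_mul_exp_le (hd : 2 ≤ d) :
    ((d - 1).choose (2 * k) : ℝ) * (2 ^ (2 * k) * Real.exp (-(3 / 8 * (16 * k * Real.log d)))) ≤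
      Real.exp (-(k * Real.log d)) := by
  have hd' : (2 : ℝ) ≤ d := by exact_mod_cast hd
  have hchoose : (d - 1).choose (2 * k) ≤ d ^ (2 * k) :=
    (Nat.choose_le_pow _ _).trans (Nat.pow_le_pow_left (Nat.sub_le d 1) _)
  calc _ ≤ (d : ℝ) ^ (2 * k) *
        ((d : ℝ) ^ (2 * k) * Real.exp (-(3 / 8 * (16 * k * Real.log d)))) := by
        gcongr
        exact_mod_cast hchoose
    _ ≤ _ := by
        rw [natCast_pow_eq_exp (by omega), ← Real.exp_add, ← Real.exp_add]
        apply Real.exp_le_exp.2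
        have : 0 ≤ k * Real.log d := mul_nonneg k.cast_nonneg (Real.log_natCast_nonneg d)
        push_cast
        linarith

end Sizes

lemma typeIError_le {SLR : Solver} {n d k : ℕ}
    (hmeas : Measurable fun q : (Fin n → ℝ) × Design n (d - 1) ↦ SLR n (d - 1) q.1 q.2 k)
    (hsparse : ∀ y X, hammingNorm (SLR n (d - 1) y X k) ≤ k) (hn : 0 < n) (hk : 1 ≤ k)
    (hd : Real.exp 1 * k ≤ d) :
    typeIError SLR n d k ≤ Real.exp (-(1 / 2 * (k * Real.log (d / k)))) := by
  have := two_mul_add_one_le_of_exp_one_mul_le hk hd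
  exact (typeIError_le_choose hmeas hsparse hn (by omega)).trans (mul_choose_mul_exp_le hk hd)

lemma typeIError_le_mul_exp {SLR : Solver} {n d k : ℕ} {C r : ℝ}
    (hmeas : Measurable fun q : (Fin n → ℝ) × Design n (d - 1) ↦ SLR n (d - 1) q.1 q.2 k)
    (hsparse : ∀ y X, hammingNorm (SLR n (d - 1) y X k) ≤ k) (hn : 0 < n) (hk : 1 ≤ k)
    (hd : Real.exp 1 * k ≤ d) (hC : 1 ≤ C) (hr : r ≤ 1 / 2) :
    typeIError SLR n d k ≤ C * Real.exp (-(r * k * Real.log (d / k))) := by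
  have hlog := one_le_log_div hk hd
  have hrate : r * (k * Real.log (d / k)) ≤ 1 / 2 * (k * Real.log (d / k)) :=
    mul_le_mul_of_nonneg_right hr (by positivity)
  calc typeIError SLR n d k ≤ 1 * Real.exp (-(1 / 2 * (k * Real.log (d / k)))) := by
        rw [one_mul]
        exact typeIError_le hmeas hsparse hn hk hd
    _ ≤ C * Real.exp (-(r * (k * Real.log (d / k)))) := by gcongr
    _ = C * Real.exp (-(r * k * Real.log (d / k))) := by rw [mul_assoc r]

/-! ### Type II error -/

lemma hammingNorm_sub_le {ι : Type*} [Fintype ι] {β : ι → Type*} [∀ i, DecidableEq (β i)]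
    [∀ i, AddCommGroup (β i)] (x y : ∀ i, β i) :
    hammingNorm (x - y) ≤ hammingNorm x + hammingNorm y := by
  have h := hammingDist_triangle y 0 x
  rw [hammingDist_zero_right, hammingDist_zero_left, add_comm] at h
  rwa [sub_eq_neg_add, ← hammingDist_eq_hammingNorm]

-- Both the estimation error `β - b` and the multiple `-β/2` of the signal are `2k`-sparse, so `hR`
-- controls the correlation of the noise with each of them.
lemma le_sqNorm_sub_sqNorm {n p k : ℕ} {X : Design n p} {w : Fin n → ℝ} {β b : Fin p → ℝ}
    {R E : ℝ} (hβ : hammingNorm β ≤ k) (hb : hammingNorm b ≤ k)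
    (hR : ∀ x : Fin p → ℝ, hammingNorm x ≤ 2 * k →
      2 * ∑ a, w a * applyDesign X x a - sqNorm (applyDesign X x) ≤ R)
    (hE : sqNorm (applyDesign X b - applyDesign X β) ≤ E) :
    1 / 2 * sqNorm (applyDesign X β) - 2 * E - 3 * R ≤
      sqNorm (applyDesign X β + w) - sqNorm (applyDesign X β + w - applyDesign X b) := by
  have herr := hR (β - b) ((hammingNorm_sub_le β b).trans (by omega))
  have hsig := hR ((-(1 / 2) : ℝ) • β) (hammingNorm_smul_le_hammingNorm.trans (by omega))
  rw [applyDesign_sub] at herr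
  rw [applyDesign_smul, sqNorm_smul] at hsig
  set v := applyDesign X β
  set z := applyDesign X b
  have hhalf : ∑ a, w a * ((-(1 / 2) : ℝ) • v) a = -(1 / 2) * ∑ a, w a * v a := by
    rw [Finset.mul_sum]
    exact Finset.sum_congr rfl fun a _ ↦ by simp [mul_left_comm]
  have hexpand : sqNorm (v + w) - sqNorm (v + w - z) =
      sqNorm v + 2 * ∑ a, w a * v a - 2 * ∑ a, w a * (v - z) a - sqNorm (v - z) := by
    simp only [sqNorm, Finset.mul_sum, ← Finset.sum_sub_distrib, ← Finset.sum_add_distrib,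
      Pi.sub_apply, Pi.add_apply]
    exact Finset.sum_congr rfl fun a _ ↦ by ring
  have hsymm : sqNorm (v - z) = sqNorm (z - v) := by
    rw [← neg_sub, ← neg_one_smul ℝ, sqNorm_smul]
    norm_num
  rw [hhalf] at hsig
  rw [hexpand]
  rw [hsymm] at herr ⊢
  linarith

lemma hammingNorm_regCoef_le {d : ℕ} (θ : ℝ) (u : Fin d → ℝ) (i : Fin d) :
    hammingNorm (regCoef θ u i) ≤ hammingNorm u := by
  classical
  unfold hammingNorm
  rw [← Finset.card_image_of_injective _ (skipIndex_injective i)]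
  refine Finset.card_le_card fun l hl ↦ ?_
  obtain ⟨j, hj, rfl⟩ := Finset.mem_image.1 hl
  simp only [Finset.mem_filter, Finset.mem_univ, true_and] at hj ⊢
  exact fun hu ↦ hj (by simp [regCoef, dropCoord, hu])

lemma le_sqNorm_regCoef {d : ℕ} {θ q : ℝ} (hθ : 0 ≤ θ) (hθ1 : θ ≤ 1) (hq : 0 ≤ q)
    {u : Fin d → ℝ} (hu : sqNorm u = 1) {i : Fin d} (h1 : q ≤ u i ^ 2) (h2 : u i ^ 2 ≤ 1 - q) :
    θ ^ 2 * q / 8 ≤ sqNorm (regCoef θ u i) := by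
  have hdrop : sqNorm (dropCoord i u) = 1 - u i ^ 2 := by
    linarith [sqNorm_eq_sq_add_sqNorm_dropCoord i u]
  have := one_add_mul_sqNorm_dropCoord_pos u i hθ
  have hle_two : 1 + θ * sqNorm (dropCoord i u) ≤ 2 := by
    rw [hdrop]
    nlinarith [sq_nonneg (u i)]
  have hprod : q / 2 ≤ u i ^ 2 * sqNorm (dropCoord i u) := by
    rw [hdrop]
    nlinarith
  have := sqNorm_nonneg (dropCoord i u)
  rw [regCoef, sqNorm_smul]
  calc θ ^ 2 * q / 8 = θ ^ 2 * (q / 2) / 2 ^ 2 := by ring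
    _ ≤ θ ^ 2 * (u i ^ 2 * sqNorm (dropCoord i u)) / (1 + θ * sqNorm (dropCoord i u)) ^ 2 := by
        gcongr
    _ = _ := by field_simp

section BlackBoxCondition

variable {SLR : Solver} {K c c' c'' : ℝ} {n p k : ℕ} {X : Design n p} {σ : ℝ≥0}
  {β : Fin p → ℝ} {g : ℝ}

lemma BlackBoxCondition.noiseLaw_real_lt_sqNorm_sub_le (h : BlackBoxCondition SLR K c c' c'')
    (hc : 0 ≤ c) (hp : 2 ≤ p) (hX : IsNormalized K X k) (hg : 0 < g)
    (hgX : g ≤ restrictedEigenvalue X k) (hσ : 0 < σ) (hβ : hammingNorm β ≤ k) :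
    (noiseLaw n σ).real {w | c / g ^ 2 * ((σ : ℝ) ^ 2 * k * Real.log p / n) <
        sqNorm (applyDesign X (SLR n p (applyDesign X β + w) X k) - applyDesign X β) / n} ≤
      c' * Real.exp (-(c'' * k * Real.log p)) := by
  have hmeas : Measurable fun w ↦
      sqNorm (applyDesign X (SLR n p (applyDesign X β + w) X k) - applyDesign X β) / n := by
    have hfit := (h.measurable n p k).comp
      ((measurable_const_add (applyDesign X β)).prodMk (measurable_const (a := X)))
    exact (measurable_sqNorm.comp ((measurable_applyDesign.comp
      (measurable_const.prodMk hfit)).sub measurable_const)).div_const _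
  have := Real.log_natCast_nonneg p
  have hgood := h.prediction_error n p k X hp hX (hg.trans_le hgX) σ hσ β hβ
  calc _ ≤ (noiseLaw n σ).real {w |
        sqNorm (applyDesign X (SLR n p (applyDesign X β + w) X k) - applyDesign X β) / n ≤
          c / restrictedEigenvalue X k ^ 2 * ((σ : ℝ) ^ 2 * k * Real.log p / n)}ᶜ := by
        refine measureReal_mono fun w hw ↦ ?_
        rw [Set.mem_compl_iff, Set.mem_ofPred_eq, not_le]
        refine lt_of_le_of_lt ?_ (Set.mem_ofPred_eq.le hw)
        gcongr
    _ ≤ _ := by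
        rw [probReal_compl_eq_one_sub (measurableSet_le hmeas measurable_const)]
        linarith

lemma BlackBoxCondition.noiseLaw_real_fitGain_le_le (h : BlackBoxCondition SLR K c c' c'')
    (hc : 0 ≤ c) (hn : 0 < n) (hp : 2 ≤ p) (hkp : 2 * k ≤ p) (hX : IsNormalized K X k)
    (hg : 0 < g) (hgX : g ≤ restrictedEigenvalue X k) (hσ : 0 < σ) (hβ : hammingNorm β ≤ k)
    {τ T : ℝ} (hτ : n * τ < 1 / 2 * sqNorm (applyDesign X β) -
      2 * (c / g ^ 2 * ((σ : ℝ) ^ 2 * k * Real.log p)) - 3 * ((σ : ℝ) ^ 2 * T)) :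
    (noiseLaw n σ).real {w | fitGain SLR X (applyDesign X β + w) k ≤ τ} ≤
      c' * Real.exp (-(c'' * k * Real.log p)) +
        p.choose (2 * k) * (2 ^ (2 * k) * Real.exp (-(3 / 8 * T))) := by
  have hn' : (0 : ℝ) < n := by exact_mod_cast hn
  refine le_trans (measureReal_mono ?_ (measure_ne_top _ _)) ((measureReal_union_le _ _).trans
    (add_le_add (h.noiseLaw_real_lt_sqNorm_sub_le hc hp hX hg hgX hσ hβ)
      (noiseLaw_real_exists_sparse_lt_le X hkp T)))
  intro w hw
  by_contra hgood
  simp only [Set.mem_union, not_or, Set.mem_ofPred_eq, not_lt, not_exists, not_and] at hgood hw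
  obtain ⟨hpred, hnoise⟩ := hgood
  rw [← mul_div_assoc, div_le_div_iff_of_pos_right hn'] at hpred
  have hgain := le_sqNorm_sub_sqNorm hβ (h.sparse n p k (applyDesign X β + w) X) hnoise hpred
  rw [fitGain, ← sub_div, div_le_iff₀ hn'] at hw
  linarith

end BlackBoxCondition

/-- The number of atoms per unit of sparsity on which a design has to be well-conditioned, with
distortion `(K + 2) / 4`, for it to be normalized with constant `K` and to have restricted
eigenvalue at least `1 / 4`. -/
noncomputable def atomScale (K : ℝ) : ℕ := ⌈max (64 * (K + 2)) (2 * (K + 2) / (K - 2))⌉₊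

/-- The exponential rate, per sample, at which a design fails to be well-conditioned on one atom
with distortion `(K + 2) / 4`. -/
noncomputable def conditioningRate (K : ℝ) : ℝ := min (chiRate (1 / 2)) (chiRate ((K + 2) / 4))

/-- The constant `c₂`: beyond `c₂ k log d` samples the conditioning rate beats the number of
atoms. -/
noncomputable def sampleConst (K : ℝ) : ℝ := (2 * atomScale K + 3) / conditioningRate K

section Constants

variable {K : ℝ} {d k n : ℕ}

lemma le_atomScale_left (K : ℝ) : 64 * (K + 2) ≤ atomScale K :=
  (le_max_left _ _).trans (Nat.le_ceil _)

lemma le_atomScale_right (K : ℝ) : 2 * (K + 2) / (K - 2) ≤ atomScale K :=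
  (le_max_right _ _).trans (Nat.le_ceil _)

lemma one_le_atomScale (hK : 2 < K) : 1 ≤ atomScale K := by
  have : (1 : ℝ) ≤ atomScale K := by linarith [le_atomScale_left K]
  exact_mod_cast this

lemma conditioningRate_pos (hK : 2 < K) : 0 < conditioningRate K :=
  lt_min (chiRate_pos (by norm_num) (by norm_num)) (chiRate_pos (by linarith) (by linarith))

lemma sampleConst_pos (hK : 2 < K) : 0 < sampleConst K := by
  have := conditioningRate_pos hK
  unfold sampleConst
  positivity

lemma pow_two_mul_atomScale_le (hd : 2 ≤ d) (hk : 1 ≤ k) :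
    (2 * (d - 1 : ℕ) : ℝ) ^ (k * atomScale K + 1) ≤
      Real.exp (2 * (atomScale K + 1) * (k * Real.log d)) := by
  have hexp : k * atomScale K + 1 ≤ k * (atomScale K + 1) := by
    rw [mul_add_one]
    omega
  have hbase : 2 * (d - 1) ≤ d ^ 2 := by
    have := Nat.mul_le_mul hd (Nat.sub_le d 1)
    rwa [← sq] at this
  calc (2 * (d - 1 : ℕ) : ℝ) ^ (k * atomScale K + 1)
      ≤ ((d : ℝ) ^ 2) ^ (k * atomScale K + 1) := by
        gcongr
        exact_mod_cast hbase
    _ = (d : ℝ) ^ (2 * (k * atomScale K + 1)) := (pow_mul _ _ _).symm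
    _ ≤ (d : ℝ) ^ (2 * (k * (atomScale K + 1))) := by
        gcongr
        exact_mod_cast (by omega : 1 ≤ d)
    _ = _ := by
        rw [natCast_pow_eq_exp (by omega)]
        push_cast
        ring_nf

lemma pow_atomScale_mul_exp_add_exp_le (hK : 2 < K) (hd : 2 ≤ d) (hk : 1 ≤ k)
    (hn : sampleConst K * k * Real.log d ≤ n) :
    (2 * (d - 1 : ℕ) : ℝ) ^ (k * atomScale K + 1) *
        (Real.exp (-(chiRate (1 / 2) * n)) + Real.exp (-(chiRate ((K + 2) / 4) * n))) ≤
      2 * Real.exp (-(k * Real.log d)) := by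
  have hsamples : (2 * atomScale K + 3) * (k * Real.log d) ≤ conditioningRate K * n := by
    rwa [sampleConst, mul_assoc, div_mul_eq_mul_div, div_le_iff₀' (conditioningRate_pos hK)] at hn
  have htail {r : ℝ} (hr : conditioningRate K ≤ r) :
      Real.exp (-(r * n)) ≤ Real.exp (-((2 * atomScale K + 3) * (k * Real.log d))) :=
    Real.exp_le_exp.2 (neg_le_neg (hsamples.trans (by gcongr)))
  calc _ ≤ Real.exp (2 * (atomScale K + 1) * (k * Real.log d)) *
        (Real.exp (-((2 * atomScale K + 3) * (k * Real.log d))) +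
          Real.exp (-((2 * atomScale K + 3) * (k * Real.log d)))) := by
        exact mul_le_mul (pow_two_mul_atomScale_le hd hk)
          (add_le_add (htail (min_le_left _ _)) (htail (min_le_right _ _)))
          (by positivity) (by positivity)
    _ = 2 * Real.exp (-(k * Real.log d)) := by
        rw [← two_mul, mul_left_comm, ← Real.exp_add]
        ring_nf

end Constants

section TypeII

variable {SLR : Solver} {K c c' c'' : ℝ} {n d k : ℕ} {u : Fin d → ℝ} {θ : ℝ}

lemma WellConditionedOnAtoms.noiseLaw_real_fitGain_le_qThreshold_le
    {X : Design n (d - 1)} {β : Fin (d - 1) → ℝ} {σ : ℝ≥0}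
    (hX : WellConditionedOnAtoms ((K + 2) / 4) (k * atomScale K + 1) X) (hK : 2 < K) (hc : 0 ≤ c)
    (h : BlackBoxCondition SLR K c c' c'') (hn : 0 < n) (hk : 1 ≤ k) (hd : Real.exp 1 * k ≤ d)
    (hσ : 0 < σ) (hσ2 : (σ : ℝ) ^ 2 ≤ 2) (hβ : hammingNorm β ≤ k)
    (hsig : (64 * c + 109) * (k * Real.log d) < n * sqNorm β / 8) :
    (noiseLaw n σ).real {w | fitGain SLR X (applyDesign X β + w) k ≤ qThreshold n d k} ≤
      c' * Real.exp (-(c'' * k * Real.log (d - 1 : ℕ))) + Real.exp (-(k * Real.log d)) := by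
  have hkd := two_mul_add_one_le_of_exp_one_mul_le hk hd
  have hn' : (0 : ℝ) < n := by exact_mod_cast hn
  have hκ : 0 ≤ (K + 2) / 4 := by linarith
  have hM1 := one_le_atomScale hK
  have hM : 256 * ((K + 2) / 4) ≤ atomScale K := by linarith [le_atomScale_left K]
  have hdesign : 1 / 4 * n * sqNorm β ≤ sqNorm (applyDesign X β) := by
    refine hX.quarter_mul_sqNorm_le hκ hk hM1 hM
      ((sq_sum_abs_le_hammingNorm_mul_sqNorm β).trans ?_)
    gcongr
    · exact sqNorm_nonneg β
    · exact_mod_cast hβ.trans (Nat.le_mul_of_pos_left k (by norm_num))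
  have hthreshold : n * qThreshold n d k ≤ 13 * (k * Real.log d) := by
    rw [qThreshold, mul_div_cancel₀ _ hn'.ne', mul_assoc]
    gcongr 13 * (k * ?_)
    exact log_div_le_log hk (by omega)
  have hprediction : c / (1 / 4) ^ 2 * ((σ : ℝ) ^ 2 * k * Real.log (d - 1 : ℕ)) ≤
      32 * c * (k * Real.log d) := by
    calc _ ≤ c / (1 / 4) ^ 2 * (2 * k * Real.log d) := by
          have := Real.log_natCast_nonneg (d - 1)
          exact mul_le_mul_of_nonneg_left (mul_le_mul (by gcongr) log_sub_one_le_log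
            this (by positivity)) (by positivity)
      _ = _ := by ring
  have hnoise : (σ : ℝ) ^ 2 * (16 * k * Real.log d) ≤ 2 * (16 * k * Real.log d) := by gcongr
  refine (h.noiseLaw_real_fitGain_le_le hc hn (by omega) (by omega)
    (hX.isNormalized hK hk hM1 (le_atomScale_right K)) (by norm_num)
    (hX.quarter_le_restrictedEigenvalue hκ hn hk (by omega) hM1 hM) hσ hβ
    (T := 16 * k * Real.log d) (by linarith)).trans ?_
  gcongr
  exact choose_two_mul_mul_exp_le (by omega)

lemma typeIIError_le_of_signal (hK : 2 < K) (hc : 0 ≤ c) (hc' : 0 ≤ c')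
    (h : BlackBoxCondition SLR K c c' c'') (hn : 0 < n) (hk : 1 ≤ k)
    (hd : Real.exp 1 * k ≤ d) (hθ : 0 ≤ θ) (hθ1 : θ ≤ 1) (hu : sqNorm u = 1)
    (huk : hammingNorm u ≤ k) {i : Fin d}
    (hsig : (64 * c + 109) * (k * Real.log d) < n * sqNorm (regCoef θ u i) / 8)
    (hnK : sampleConst K * k * Real.log d ≤ n) :
    typeIIError SLR n d k θ u ≤ 3 * Real.exp (-(k * Real.log d)) +
      c' * Real.exp (-(c'' * k * Real.log (d - 1 : ℕ))) := by
  have hkd := two_mul_add_one_le_of_exp_one_mul_le hk hd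
  calc typeIIError SLR n d k θ u
      ≤ (sampleLaw n d (spikedCov θ u)).real
          {x | (dropColumn (dataMatrix x) i, column (dataMatrix x) i) ∈
            {q : Design n (d - 1) × (Fin n → ℝ) | fitGain SLR q.1 q.2 k ≤ qThreshold n d k}} :=
        measureReal_mono fun x hx ↦ (qTest_eq_zero_iff _ _ _).1 hx i
    _ ≤ _ := sampleLaw_real_le_add hθ u i
        (measurableSet_le (measurable_fitGain (h.measurable n (d - 1) k)) measurable_const)
        (by positivity) fun X hX ↦
          (not_not.1 hX).noiseLaw_real_fitGain_le_qThreshold_le hK hc h hn hk hd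
            (residualSd_pos u i hθ) (residualSd_sq_le_two i hθ hθ1 hu)
            ((hammingNorm_regCoef_le θ u i).trans huk) hsig
    _ ≤ _ := add_le_add_left (measureReal_not_wellConditionedOnAtoms_le
        (exists_measurePreserving_applyDesign_restLaw i n hθ hθ1 hu) (by linarith)
        (k * atomScale K + 1)) _
    _ ≤ _ := by
        linarith [pow_atomScale_mul_exp_add_exp_le hK (by omega) hk hnK]

lemma signal_lt_sqNorm_regCoef {cmin : ℝ} (hn : 0 < n) (hk : 1 ≤ k)
    (hcmin : 0 < cmin) (hθ : 0 ≤ θ) (hθ1 : θ ≤ 1) (hu : sqNorm u = 1) {i : Fin d}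
    (h1 : cmin ^ 2 / k ≤ u i ^ 2) (h2 : u i ^ 2 ≤ 1 - cmin ^ 2 / k)
    (hsig : 64 * c / cmin ^ 2 * ((k : ℝ) ^ 2 * Real.log d / n) < θ ^ 2) :
    c * (k * Real.log d) < n * sqNorm (regCoef θ u i) / 8 := by
  have : (0 : ℝ) < k := by exact_mod_cast hk
  have : (0 : ℝ) < n := by exact_mod_cast hn
  have hreg := le_sqNorm_regCoef hθ hθ1 (by positivity) hu h1 h2
  calc c * (k * Real.log d)
      = n * ((64 * c / cmin ^ 2 * ((k : ℝ) ^ 2 * Real.log d / n)) * (cmin ^ 2 / k) / 8) / 8 := by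
        field_simp
        norm_num
    _ < n * (θ ^ 2 * (cmin ^ 2 / k) / 8) / 8 := by gcongr
    _ ≤ n * sqNorm (regCoef θ u i) / 8 := by gcongr

lemma typeIIError_le {cmin : ℝ} (hK : 2 < K) (hc : 0 ≤ c) (hc' : 0 ≤ c') (hc'' : 0 ≤ c'')
    (h : BlackBoxCondition SLR K c c' c'') (hn : 0 < n) (hk : 1 ≤ k)
    (hd : Real.exp 1 * k ≤ d) (hcmin : 0 < cmin) (hθ : 0 ≤ θ) (hθ1 : θ ≤ 1)
    (hu : sqNorm u = 1) (huk : hammingNorm u ≤ k)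
    (hui : ∃ i, cmin ^ 2 / k ≤ u i ^ 2 ∧ u i ^ 2 ≤ 1 - cmin ^ 2 / k)
    (hsig : 64 * (64 * c + 109) / cmin ^ 2 * ((k : ℝ) ^ 2 * Real.log d / n) < θ ^ 2)
    (hnK : sampleConst K * k * Real.log d ≤ n) :
    typeIIError SLR n d k θ u ≤
      (3 + c') * Real.exp (-(min (1 / 2) (c'' / 2) * k * Real.log d)) := by
  obtain ⟨i, hi1, hi2⟩ := hui
  have hkd := two_mul_add_one_le_of_exp_one_mul_le hk hd
  have hL : 0 ≤ k * Real.log d := mul_nonneg k.cast_nonneg (Real.log_natCast_nonneg d)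
  have hhalf : min (1 / 2) (c'' / 2) * (k * Real.log d) ≤ 1 / 2 * (k * Real.log d) :=
    mul_le_mul_of_nonneg_right (min_le_left _ _) hL
  have hblack : min (1 / 2) (c'' / 2) * (k * Real.log d) ≤ c'' / 2 * (k * Real.log d) :=
    mul_le_mul_of_nonneg_right (min_le_right _ _) hL
  have hlog : c'' / 2 * k * Real.log d ≤ c'' / 2 * k * (2 * Real.log (d - 1 : ℕ)) := by
    gcongr
    exact log_le_two_mul_log_sub_one (by omega)
  calc typeIIError SLR n d k θ u
      ≤ 3 * Real.exp (-(k * Real.log d)) +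
          c' * Real.exp (-(c'' * k * Real.log (d - 1 : ℕ))) :=
        typeIIError_le_of_signal hK hc hc' h hn hk hd hθ hθ1 hu huk
          (signal_lt_sqNorm_regCoef hn hk hcmin hθ hθ1 hu hi1 hi2 hsig) hnK
    _ ≤ 3 * Real.exp (-(min (1 / 2) (c'' / 2) * k * Real.log d)) +
          c' * Real.exp (-(min (1 / 2) (c'' / 2) * k * Real.log d)) :=
        add_le_add
          (mul_le_mul_of_nonneg_left (Real.exp_le_exp.2 (by linarith)) zero_le_three)
          (mul_le_mul_of_nonneg_left (Real.exp_le_exp.2 (by linarith)) hc')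
    _ = _ := (add_mul _ _ _).symm

end TypeII

lemma max_le_of_exp_bounds {e₁ e₂ C a ε : ℝ} {d k : ℕ} (hC : 0 ≤ C) (ha : 0 ≤ a) (hk : 1 ≤ k)
    (hd : 0 < d) (h₁ : e₁ ≤ C * Real.exp (-(a * k * Real.log (d / k))))
    (h₂ : e₂ ≤ C * Real.exp (-(a * k * Real.log d))) (hε : ε ≤ 1)
    (hkd : (k : ℝ) ≤ (d : ℝ) ^ (1 - ε)) :
    max e₁ e₂ ≤ C * Real.exp (-(a * ε * k * Real.log d)) := by
  have hak : 0 ≤ a * k := by positivity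
  have hquot := mul_le_mul_of_nonneg_left (mul_log_le_log_div_of_le_rpow hk hd hkd) hak
  have hself := mul_le_mul_of_nonneg_left
    (mul_le_of_le_one_left (Real.log_natCast_nonneg d) hε) hak
  refine max_le (h₁.trans ?_) (h₂.trans ?_) <;>
    exact mul_le_mul_of_nonneg_left (Real.exp_le_exp.2 (by linarith)) hC

/-! ### Running time -/

namespace QProgram

section Runs

/-- A timed Hoare triple: started in the state `s`, the program `P` reaches a state satisfying `Q`
in at most `t` steps. -/
def Runs (SLR : Solver) (T : ℕ → ℕ → ℕ → ℕ) (P : Prog) (s : MachineState)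
    (Q : MachineState → Prop) (t : ℕ) : Prop :=
  Q (P.exec SLR T s).1 ∧ (P.exec SLR T s).2 ≤ t

variable {SLR : Solver} {T : ℕ → ℕ → ℕ → ℕ} {P : Prog} {Ps : List Prog} {s : MachineState}
  {Q R : MachineState → Prop} {t t' : ℕ}

lemma Runs.mono (h : Runs SLR T P s Q t) (ht : t ≤ t') (hQ : ∀ s', Q s' → R s') :
    Runs SLR T P s R t' :=
  ⟨hQ _ h.1, h.2.trans ht⟩

lemma Runs.nil (h : Q s) : Runs SLR T (Prog.block []) s Q 1 := ⟨h, le_rfl⟩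

lemma Runs.cons (h : Runs SLR T P s R t)
    (h' : ∀ s', R s' → Runs SLR T (Prog.block Ps) s' Q t') :
    Runs SLR T (Prog.block (P :: Ps)) s Q (t + t') :=
  ⟨(h' _ h.1).1, add_le_add h.2 (h' _ h.1).2⟩

lemma Runs.step (h : Runs SLR T (Prog.block Ps) (P.exec SLR T s).1 Q t)
    (hone : (P.exec SLR T s).2 = 1 := by rfl) :
    Runs SLR T (Prog.block (P :: Ps)) s Q (1 + t) :=
  Runs.cons (R := (· = (P.exec SLR T s).1)) ⟨rfl, hone.le⟩ fun _ hs ↦ hs ▸ h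

lemma Runs.loop {x m N : ℕ} (I : ℕ → MachineState → Prop) (hN : s.nat m = N) (h0 : I 0 s)
    (hstep : ∀ (i : Fin N) (s' : MachineState), I i s' →
      Runs SLR T P (s'.setNat x i) (I (i + 1)) t) :
    Runs SLR T (.loop x m P) s (I N) (1 + N * (t + 1)) := by
  have key : ∀ M ≤ N, I M (runLoop (P.exec SLR T) x s M).1 ∧
      (runLoop (P.exec SLR T) x s M).2 ≤ 1 + M * (t + 1) := by
    intro M
    induction M with
    | zero => exact fun _ ↦ ⟨h0, by simp [runLoop]⟩
    | succ M ih =>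
      intro hM
      obtain ⟨hinv, htime⟩ := ih (by omega)
      obtain ⟨hinv', htime'⟩ := hstep ⟨M, hM⟩ _ hinv
      refine ⟨hinv', ?_⟩
      simp only [runLoop]
      linarith
  subst hN
  exact key _ le_rfl

end Runs

/-- What the machine remembers while it processes the column with index `i`, the current output
being `o`: the contents of all registers and arrays other than scratch space. -/
structure Frame {n d : ℕ} (X : Design n d) (k i o : ℕ) (s : MachineState) : Prop where
  rows : s.nat 0 = n
  cols : s.nat 1 = d
  sparsity : s.nat 2 = k
  output : s.nat 3 = o
  zero : s.nat 4 = 0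
  one : s.nat 5 = 1
  others : s.nat 6 = d - 1
  index : s.nat 7 = i
  threshold : s.real 0 = qThreshold n d k
  samples : s.real 1 = n
  data : ∀ (a : Fin n) (j : Fin d), s.mem 0 a j = X a j

namespace Frame

variable {n d : ℕ} {X : Design n d} {k i o : ℕ} {s s' : MachineState}

lemma congr (h : Frame X k i o s) (hnat : ∀ x < 8, s'.nat x = s.nat x)
    (hreal : ∀ r < 2, s'.real r = s.real r) (hmem : s'.mem 0 = s.mem 0) : Frame X k i o s' where
  rows := (hnat 0 (by norm_num)).trans h.rows
  cols := (hnat 1 (by norm_num)).trans h.cols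
  sparsity := (hnat 2 (by norm_num)).trans h.sparsity
  output := (hnat 3 (by norm_num)).trans h.output
  zero := (hnat 4 (by norm_num)).trans h.zero
  one := (hnat 5 (by norm_num)).trans h.one
  others := (hnat 6 (by norm_num)).trans h.others
  index := (hnat 7 (by norm_num)).trans h.index
  threshold := (hreal 0 (by norm_num)).trans h.threshold
  samples := (hreal 1 (by norm_num)).trans h.samples
  data a j := by rw [hmem, h.data]

lemma setNat (h : Frame X k i o s) {x : ℕ} (hx : 8 ≤ x) (v : ℕ) : Frame X k i o (s.setNat x v) :=
  h.congr (fun _ _ ↦ if_neg (by omega)) (fun _ _ ↦ rfl) rfl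

lemma setReal (h : Frame X k i o s) {r : ℕ} (hr : 2 ≤ r) (v : ℝ) :
    Frame X k i o (s.setReal r v) :=
  h.congr (fun _ _ ↦ rfl) (fun _ _ ↦ if_neg (by omega)) rfl

lemma setMem (h : Frame X k i o s) {A : ℕ} (hA : A ≠ 0) (x y : ℕ) (v : ℝ) :
    Frame X k i o (s.setMem A x y v) :=
  h.congr (fun _ _ ↦ rfl) (fun _ _ ↦ rfl)
    (funext₂ fun _ _ ↦ if_neg fun h' ↦ hA h'.1.symm)

lemma setVec (h : Frame X k i o s) {A : ℕ} (hA : A ≠ 0) {p : ℕ} (v : Fin p → ℝ) :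
    Frame X k i o (s.setVec A v) :=
  h.congr (fun _ _ ↦ rfl) (fun _ _ ↦ rfl)
    (funext₂ fun _ _ ↦ dif_neg fun h' ↦ hA h'.1.symm)

lemma setIndex (h : Frame X k i o s) (v : ℕ) : Frame X k v o (s.setNat 7 v) :=
  { h with index := rfl }

lemma setOutput (h : Frame X k i o s) (v : ℕ) : Frame X k i v (s.setNat 3 v) :=
  { h with output := rfl }

end Frame

attribute [local simp] Prog.exec MachineState.setNat MachineState.setReal MachineState.setMem
  MachineState.setVec

variable {n d : ℕ} {X : Design n d} {k o : ℕ} {l : Fin d} {s : MachineState}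
  (SLR : Solver) (T : ℕ → ℕ → ℕ → ℕ)

/-- The body of the inner loop of `writeInstance`. -/
def writeEntry : Prog := Prog.block [
  .natIfLt 9 7 (.natAdd 10 9 4) (.natAdd 10 9 5),
  .load 5 0 8 10, .store 2 8 9 5]

/-- The body of the outer loop of `writeInstance`. -/
def writeRow : Prog := Prog.block [.load 5 0 8 7, .store 1 8 4 5, .loop 9 6 writeEntry]

lemma runs_writeEntry (h : Frame X k l o s) (a : Fin n) (h8 : s.nat 8 = a) (j : Fin (d - 1)) :
    Runs SLR T writeEntry (s.setNat 9 j) (fun s' ↦ Frame X k l o s' ∧ s'.nat 8 = a ∧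
      s'.mem = (s.setMem 2 a j (dropColumn X l a j)).mem) 5 := by
  have hskip : Runs SLR T (.natIfLt 9 7 (.natAdd 10 9 4) (.natAdd 10 9 5)) (s.setNat 9 j)
      (· = (s.setNat 9 j).setNat 10 (skipIndex l j)) 2 := by
    unfold Runs
    simp only [Prog.exec, MachineState.setNat, h.index, h.zero, h.one, skipIndex]
    split_ifs <;> simp_all
  refine Runs.cons (t' := 3) hskip ?_
  rintro _ rfl
  refine Runs.step (Runs.step (Runs.nil ⟨?_, h8, ?_⟩))
  · exact (((h.setNat (by norm_num) _).setNat (by norm_num) _).setReal (by norm_num) _).setMem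
      (by norm_num) _ _ _
  · simp [h8, h.data, dropColumn]

lemma runs_writeRow (h : Frame X k l o s) (a : Fin n) :
    Runs SLR T writeRow (s.setNat 8 a) (fun s' ↦ Frame X k l o s' ∧
      s'.mem 1 a 0 = column X l a ∧ (∀ j : Fin (d - 1), s'.mem 2 a j = dropColumn X l a j) ∧
      ∀ a' ≠ (a : ℕ), s'.mem 1 a' = s.mem 1 a' ∧ s'.mem 2 a' = s.mem 2 a')
      (4 + 6 * (d - 1)) := by
  refine Runs.mono (Runs.step (Runs.step (Runs.cons (Runs.loop (t := 5) (fun j s' ↦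
    Frame X k l o s' ∧ s'.nat 8 = a ∧ s'.mem 1 a 0 = column X l a ∧
      (∀ j' : Fin (d - 1), j' < j → s'.mem 2 a j' = dropColumn X l a j') ∧
      ∀ a' ≠ (a : ℕ), s'.mem 1 a' = s.mem 1 a' ∧ s'.mem 2 a' = s.mem 2 a')
    h.others ⟨?_, rfl, ?_, by simp, ?_⟩ ?_) fun s' hs' ↦ Runs.nil hs'))) (by omega) ?_
  · exact ((h.setNat le_rfl _).setReal (by norm_num) _).setMem (by norm_num) _ _ _
  · simp [h.zero, h.index, h.data, column]
  · intro a' ha'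
    simp [ha']
  · rintro j s₁ ⟨hF, h8, hy, hZ, hrest⟩
    refine (runs_writeEntry SLR T hF a h8 j).mono le_rfl ?_
    rintro s₂ ⟨hF', h8', hmem⟩
    rw [hmem]
    refine ⟨hF', h8', by simpa using hy, fun j' hj' ↦ ?_, fun a' ha' ↦ ?_⟩
    · obtain hlt | heq := Nat.lt_succ_iff_lt_or_eq.1 hj'
      · simpa [hlt.ne] using hZ j' hlt
      · simp [Fin.ext heq]
    · simpa [ha'] using hrest a' ha'
  · rintro s' ⟨hF, -, hy, hZ, hrest⟩
    exact ⟨hF, hy, fun j ↦ hZ j j.2, hrest⟩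

lemma runs_writeInstance (h : Frame X k l o s) :
    Runs SLR T writeInstance s (fun s' ↦ Frame X k l o s' ∧
      (∀ a : Fin n, s'.mem 1 a 0 = column X l a) ∧
      ∀ (a : Fin n) (j : Fin (d - 1)), s'.mem 2 a j = dropColumn X l a j)
      (1 + n * (5 + 6 * (d - 1))) := by
  refine (Runs.loop (t := 4 + 6 * (d - 1)) (fun a s' ↦ Frame X k l o s' ∧
    ∀ a' : Fin n, a' < a → s'.mem 1 a' 0 = column X l a' ∧
      ∀ j : Fin (d - 1), s'.mem 2 a' j = dropColumn X l a' j) h.rows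
    ⟨h, by simp⟩ ?_).mono (le_of_eq (by ring)) ?_
  · rintro a s₁ ⟨hF, hrows⟩
    refine (runs_writeRow SLR T hF a).mono le_rfl ?_
    rintro s₂ ⟨hF', hy, hZ, hrest⟩
    refine ⟨hF', fun a' ha' ↦ ?_⟩
    obtain hlt | heq := Nat.lt_succ_iff_lt_or_eq.1 ha'
    · rw [(hrest a' hlt.ne).1, (hrest a' hlt.ne).2]
      exact hrows a' hlt
    · obtain rfl := Fin.ext heq
      exact ⟨hy, hZ⟩
  · rintro s' ⟨hF, hrows⟩
    exact ⟨hF, fun a ↦ (hrows a a.2).1, fun a ↦ (hrows a a.2).2⟩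

/-- The body of the inner loop of `sums`. -/
def subtractTerm : Prog := Prog.block [.load 5 2 8 9, .load 6 3 9 4, .realMul 5 5 6, .realSub 4 4 5]

/-- The body of the outer loop of `sums`. -/
def addRow : Prog := Prog.block [
  .load 4 1 8 4, .realMul 5 4 4, .realAdd 2 2 5, .loop 9 6 subtractTerm,
  .realMul 5 4 4, .realAdd 3 3 5]

section Sums

variable {i : ℕ}

lemma runs_subtractTerm (h : Frame X k i o s) (j : ℕ) :
    Runs SLR T subtractTerm (s.setNat 9 j) (fun s' ↦ Frame X k i o s' ∧ s'.mem = s.mem ∧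
      s'.nat 8 = s.nat 8 ∧ s'.real 2 = s.real 2 ∧ s'.real 3 = s.real 3 ∧
      s'.real 4 = s.real 4 - s.mem 2 (s.nat 8) j * s.mem 3 j 0) 5 := by
  refine ⟨⟨?_, rfl, rfl, rfl, rfl, ?_⟩, le_rfl⟩
  · exact ((((h.setNat (by norm_num) _).setReal (by norm_num) _).setReal (by norm_num) _).setReal
      (by norm_num) _).setReal (by norm_num) _
  · simp [subtractTerm, Prog.block, Prog.exec, h.zero]

lemma runs_addRow (h : Frame X k i o s) (a : ℕ) :
    Runs SLR T addRow (s.setNat 8 a) (fun s' ↦ Frame X k i o s' ∧ s'.mem = s.mem ∧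
      s'.real 2 = s.real 2 + s.mem 1 a 0 ^ 2 ∧
      s'.real 3 = s.real 3 +
        (s.mem 1 a 0 - ∑ j ∈ Finset.range (d - 1), s.mem 2 a j * s.mem 3 j 0) ^ 2)
      (7 + 6 * (d - 1)) := by
  refine Runs.mono (Runs.step (Runs.step (Runs.step (Runs.cons (t' := 3)
    (Runs.loop (t := 5) (fun j s' ↦ Frame X k i o s' ∧ s'.mem = s.mem ∧ s'.nat 8 = a ∧
      s'.real 2 = s.real 2 + s.mem 1 a 0 ^ 2 ∧ s'.real 3 = s.real 3 ∧
      s'.real 4 = s.mem 1 a 0 - ∑ j' ∈ Finset.range j, s.mem 2 a j' * s.mem 3 j' 0)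
      h.others ⟨?_, rfl, rfl, ?_, rfl, ?_⟩ ?_) ?_)))) (by omega) fun _ hs' ↦ hs'
  · exact (((h.setNat le_rfl _).setReal (by norm_num) _).setReal (by norm_num) _).setReal
      (by norm_num) _
  · simp [h.zero, sq]
  · simp [h.zero]
  · rintro j s₁ ⟨hF, hmem, h8, h2, h3, h4⟩
    refine (runs_subtractTerm SLR T hF j).mono le_rfl ?_
    rintro s₂ ⟨hF', hmem', h8', h2', h3', h4'⟩
    refine ⟨hF', hmem'.trans hmem, h8'.trans h8, h2'.trans h2, h3'.trans h3, ?_⟩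
    rw [h4', h4, h8, hmem, Finset.sum_range_succ, sub_sub]
  · rintro s₁ ⟨hF, hmem, -, h2, h3, h4⟩
    refine Runs.step (Runs.step (Runs.nil ⟨?_, hmem, h2, ?_⟩))
    · exact (hF.setReal (by norm_num) _).setReal (by norm_num) _
    · simp [h3, h4, sq]

lemma runs_sums (h : Frame X k i o s) {y : Fin n → ℝ} {Z : Design n (d - 1)} {b : Fin (d - 1) → ℝ}
    (hy : ∀ a : Fin n, s.mem 1 a 0 = y a)
    (hZ : ∀ (a : Fin n) (j : Fin (d - 1)), s.mem 2 a j = Z a j)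
    (hb : ∀ j : Fin (d - 1), s.mem 3 j 0 = b j) :
    Runs SLR T sums s (fun s' ↦ Frame X k i o s' ∧ s'.real 2 = sqNorm y ∧
      s'.real 3 = sqNorm (y - applyDesign Z b)) (4 + n * (8 + 6 * (d - 1))) := by
  refine Runs.mono (Runs.step (Runs.step (Runs.cons (Runs.loop (t := 7 + 6 * (d - 1)) (fun a s' ↦
    Frame X k i o s' ∧ s'.mem = s.mem ∧
      s'.real 2 = ∑ a' ∈ Finset.range a, s.mem 1 a' 0 ^ 2 ∧
      s'.real 3 = ∑ a' ∈ Finset.range a,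
        (s.mem 1 a' 0 - ∑ j ∈ Finset.range (d - 1), s.mem 2 a' j * s.mem 3 j 0) ^ 2)
    h.rows ⟨?_, rfl, ?_, ?_⟩ ?_) fun s' hs' ↦ Runs.nil hs'))) (le_of_eq (by ring)) ?_
  · exact (h.setReal (by norm_num) _).setReal (by norm_num) _
  · simp
  · simp
  · rintro a s₁ ⟨hF, hmem, h2, h3⟩
    refine (runs_addRow SLR T hF a).mono le_rfl ?_
    rintro s₂ ⟨hF', hmem', h2', h3'⟩
    refine ⟨hF', hmem'.trans hmem, ?_, ?_⟩
    · rw [h2', h2, hmem, Finset.sum_range_succ]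
    · rw [h3', h3, hmem, Finset.sum_range_succ _ (a : ℕ)]
  · rintro s' ⟨hF, -, h2, h3⟩
    refine ⟨hF, ?_, ?_⟩
    · simp only [h2, Finset.sum_range, hy, sqNorm]
    · simp only [h3, Finset.sum_range, hy, hZ, hb, sqNorm, Pi.sub_apply, applyDesign]

end Sums

lemma runs_call {n p k : ℕ} (hn : s.nat 0 = n) (hp : s.nat 6 = p) (hk : s.nat 2 = k)
    {y : Fin n → ℝ} {Z : Design n p} (hy : ∀ a : Fin n, s.mem 1 a 0 = y a)
    (hZ : ∀ (a : Fin n) (j : Fin p), s.mem 2 a j = Z a j) :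
    Runs SLR T (.call 1 2 3 0 6 2) s (· = s.setVec 3 (SLR n p y Z k)) (T p n k + 1) := by
  subst hn hp hk
  obtain rfl : (fun a : Fin _ ↦ s.mem 1 a 0) = y := funext hy
  obtain rfl : (fun (a : Fin _) (j : Fin _) ↦ s.mem 2 a j) = Z := funext₂ hZ
  exact ⟨rfl, le_rfl⟩

/-- The final part of the loop of `main`: the comparison of `Q_i` with the threshold. -/
def updateOutput : Prog := Prog.block [
  .realDiv 2 2 1, .realDiv 3 3 1, .realSub 5 2 3, .realIfLt 0 5 (.natConst 3 1) .skip]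

/-- The body of the loop of `main`. -/
def testColumn : Prog := Prog.block [
  writeInstance, .call 1 2 3 0 6 2, sums,
  .realDiv 2 2 1, .realDiv 3 3 1, .realSub 5 2 3, .realIfLt 0 5 (.natConst 3 1) .skip]

open Classical in
lemma runs_updateOutput {i : ℕ} (h : Frame X k i o s) :
    Runs SLR T updateOutput s
      (Frame X k i (if qThreshold n d k < s.real 2 / n - s.real 3 / n then 1 else o)) 6 := by
  let s' := ((s.setReal 2 (s.real 2 / s.real 1)).setReal 3 (s.real 3 / s.real 1)).setReal 5
    (s.real 2 / s.real 1 - s.real 3 / s.real 1)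
  have hF : Frame X k i o s' :=
    ((h.setReal (by norm_num) _).setReal (by norm_num) _).setReal (by norm_num) _
  have hbranch : Runs SLR T (.realIfLt 0 5 (.natConst 3 1) .skip) s'
      (Frame X k i (if qThreshold n d k < s.real 2 / n - s.real 3 / n then 1 else o)) 2 := by
    have h5 : s'.real 5 = s.real 2 / n - s.real 3 / n := by simp [s', h.samples]
    unfold Runs
    simp only [Prog.exec, h5, hF.threshold]
    split_ifs
    · exact ⟨hF.setOutput 1, le_rfl⟩
    · exact ⟨hF, le_rfl⟩
  refine Runs.step (Runs.step (Runs.step (Runs.cons (t := 2) ?_ fun _ hs' ↦ Runs.nil hs')))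
  exact hbranch

open Classical in
lemma runs_testColumn (h : Frame X k l o s) :
    Runs SLR T testColumn s (Frame X k l (if qThreshold n d k < qStat SLR X k l then 1 else o))
      (T (d - 1) n k + 12 + n * (13 + 12 * (d - 1))) := by
  refine (Runs.cons (t' := T (d - 1) n k + 1 + (4 + n * (8 + 6 * (d - 1)) + 6))
    (runs_writeInstance SLR T h) ?_).mono (le_of_eq (by ring)) fun _ hs' ↦ hs'
  rintro s₁ ⟨hF, hy, hZ⟩
  refine Runs.cons (runs_call SLR T hF.rows hF.others hF.sparsity hy hZ) ?_
  rintro _ rfl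
  refine Runs.cons (runs_sums SLR T (hF.setVec (by norm_num) _)
    (y := column X l) (Z := dropColumn X l)
    (b := SLR n (d - 1) (column X l) (dropColumn X l) k) ?_ ?_ ?_) ?_
  · simpa using hy
  · simpa using hZ
  · simp
  rintro s₂ ⟨hF', h2, h3⟩
  have hout := runs_updateOutput SLR T hF'
  rwa [h2, h3] at hout

lemma runs_setup (X : Design n d) (k : ℕ) :
    Runs SLR T setup (inputState X k) (Frame X k 0 0) 14 := by
  refine ⟨⟨rfl, rfl, rfl, rfl, rfl, rfl, rfl, rfl, ?_, ?_, ?_⟩, le_rfl⟩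
  all_goals simp [setup, Prog.block, Prog.exec, inputState, qThreshold]

lemma exists_lt_succ_and_iff {p : Fin d → Prop} (l : Fin d) :
    (∃ i : Fin d, (i : ℕ) < l + 1 ∧ p i) ↔ p l ∨ ∃ i : Fin d, (i : ℕ) < l ∧ p i := by
  simp only [Nat.lt_succ_iff_lt_or_eq, ← Fin.ext_iff, or_and_right, exists_or, exists_eq_left,
    or_comm]

open Classical in
lemma runs_main (X : Design n d) (k : ℕ) :
    Runs SLR T main (inputState X k) (fun s' ↦ s'.nat 3 = qTest SLR X k)
      (14 + (1 + d * (T (d - 1) n k + 12 + n * (13 + 12 * (d - 1)) + 1))) := by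
  obtain ⟨hsetup, hsetup_time⟩ := runs_setup SLR T X k
  obtain ⟨⟨i, hF⟩, htime⟩ := Runs.loop (SLR := SLR) (T := T) (x := 7) (P := testColumn)
    (t := T (d - 1) n k + 12 + n * (13 + 12 * (d - 1)))
    (fun l s' ↦ ∃ i, Frame X k i
      (if ∃ i : Fin d, (i : ℕ) < l ∧ qThreshold n d k < qStat SLR X k i then 1 else 0) s')
    hsetup.cols ⟨0, by simpa using hsetup⟩ fun l s' ⟨_, hF⟩ ↦
      (runs_testColumn SLR T (hF.setIndex l)).mono le_rfl fun s'' hF' ↦ ⟨l, by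
        simpa only [exists_lt_succ_and_iff, ite_or] using hF'⟩
  refine ⟨hF.output.trans ?_, add_le_add hsetup_time htime⟩
  simp only [qTest, Fin.is_lt, true_and]

lemma runs_main_of_pos (hd : 1 ≤ d) (hn : 1 ≤ n) (X : Design n d) (k : ℕ) :
    Runs SLR T main (inputState X k) (fun s' ↦ s'.nat 3 = qTest SLR X k)
      (42 * (d * T (d - 1) n k + d ^ 2 * n)) := by
  refine (runs_main SLR T X k).mono ?_ fun _ hs' ↦ hs'
  have hone : 1 ≤ d ^ 2 * n := Nat.mul_pos (by positivity) hn
  have hlin : d ≤ d ^ 2 * n := by nlinarith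
  have hquad : d * (n * (13 + 12 * (d - 1))) ≤ 13 * (d ^ 2 * n) := by
    calc d * (n * (13 + 12 * (d - 1))) ≤ d * (n * (13 * d)) := by
          gcongr
          omega
      _ = 13 * (d ^ 2 * n) := by ring
  have hexpand : d * (T (d - 1) n k + 12 + n * (13 + 12 * (d - 1)) + 1) =
      d * T (d - 1) n k + 13 * d + d * (n * (13 + 12 * (d - 1))) := by ring
  rw [hexpand]
  linarith [Nat.zero_le (d * T (d - 1) n k)]

end QProgram

theorem theorem1 :
    -- error probabilities
    (∀ K c c' c'' : ℝ, 2 < K → 0 < c → 0 < c' → 0 < c'' →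
      ∃ c₁ c₂ c₃ c₄ : ℝ, 0 < c₁ ∧ 0 < c₂ ∧ 0 < c₃ ∧ 0 < c₄ ∧
        ∀ SLR : Solver, BlackBoxCondition SLR K c c' c'' →
        ∀ (d n k : ℕ) (cmin θ : ℝ) (u : Fin d → ℝ),
          1 ≤ k → Real.exp 1 * k ≤ d → 0 < cmin → 0 < θ → θ ≤ 1 →
          sqNorm u = 1 → hammingNorm u ≤ k →
          (∃ i, cmin ^ 2 / k ≤ u i ^ 2 ∧ u i ^ 2 ≤ 1 - cmin ^ 2 / k) →
          θ ^ 2 > c₁ / cmin ^ 2 * ((k : ℝ) ^ 2 * Real.log d / n) →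
          (n : ℝ) > c₂ * k * Real.log d →
            typeIError SLR n d k ≤ c₃ * Real.exp (-(c₄ * k * Real.log (d / k))) ∧
            typeIIError SLR n d k θ u ≤ c₃ * Real.exp (-(c₄ * k * Real.log d)) ∧
            ∀ ε : ℝ, 0 < ε → ε ≤ 1 → (k : ℝ) ≤ (d : ℝ) ^ (1 - ε) →
              max (typeIError SLR n d k) (typeIIError SLR n d k θ u) ≤
                c₃ * Real.exp (-(c₄ * ε * k * Real.log d))) ∧
    -- running time
    (∃ C : ℕ, ∀ (SLR : Solver) (T : ℕ → ℕ → ℕ → ℕ) (d n k : ℕ) (X : Design n d),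
      1 ≤ d → 1 ≤ n →
        (QProgram.main.exec SLR T (inputState X k)).1.nat 3 = qTest SLR X k ∧
        (QProgram.main.exec SLR T (inputState X k)).2 ≤ C * (d * T (d - 1) n k + d ^ 2 * n)) := by
  refine ⟨fun K c c' c'' hK hc hc' hc'' ↦ ?_,
    42, fun SLR T d n k X hd hn ↦ QProgram.runs_main_of_pos SLR T hd hn X k⟩
  have hrate : 0 < min (1 / 2) (c'' / 2) := by positivity
  refine ⟨64 * (64 * c + 109), sampleConst K, 3 + c', min (1 / 2) (c'' / 2), by positivity,
    sampleConst_pos hK, by positivity, hrate, ?_⟩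
  intro SLR h d n k cmin θ u hk hd hcmin hθ hθ1 hu huk hui hsig hnK
  have hkd := two_mul_add_one_le_of_exp_one_mul_le hk hd
  have hn : 0 < n := by
    have := sampleConst_pos hK
    have := Real.log_natCast_nonneg d
    exact_mod_cast (by positivity : 0 ≤ sampleConst K * k * Real.log d).trans_lt hnK
  have hI : typeIError SLR n d k ≤
      (3 + c') * Real.exp (-(min (1 / 2) (c'' / 2) * k * Real.log (d / k))) :=
    typeIError_le_mul_exp (h.measurable n (d - 1) k) (h.sparse n (d - 1) k) hn hk hd
      (by linarith) (min_le_left _ _)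
  have hII := typeIIError_le hK hc.le hc'.le hc''.le h hn hk hd hcmin hθ.le hθ1 hu huk hui
    hsig hnK.le
  exact ⟨hI, hII, fun ε _ hε hkε ↦
    max_le_of_exp_bounds (by positivity) hrate.le hk (by omega) hI hII hε hkε⟩
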